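/- Let $\mathbb D$ be the open unit disk, $\mathbb T$ the unit circle, and $dA$ the area measure on $\mathbb D$ normalized so that $A(\mathbb D)=1$. For a weight $\omega:\mathbb D\to[0,\infty]$ and a holomorphic function $f$ on $\mathbb D$, put $$\mathcal D_\omega(f)=\int_{\mathbb D}|f'(z)|^2\,\omega(z)\,dA(z)\in[0,\infty],$$ and let $\mathcal D_\omega$ also denote the set of holomorphic $f$ on $\mathbb D$ with $\mathcal D_\omega(f)<\infty$. For $0\le r<1$ write $f_r(z)=f(rz)$. For a finite positive Borel measure $\mu$ on $\overline{\mathbb D}$, write $\mathcal D_\mu$ for $\mathcal D_{\omega}$ with the weight $$\omega(z)=\int_{\mathbb D}\log\Bigl|\frac{1-\overline\zeta z}{\zeta-z}\Bigr|\,\frac{2}{1-|\zeta|^2}\,d\mu(\zeta)+\int_{\mathbb T}\frac{1-|z|^2}{|\zeta-z|^2}\,d\mu(\zeta)\qquad(z\in\mathbb D),$$ the first integrand being $+\infty$ at $\zeta=z$. (1) Let $\mu$ be a finite positive Borel measure on $\overline{\mathbb D}$ and let $f\in\mathcal D_\mu$. Then $$\mathcal D_\mu(f_r)\le\frac{2r}{1+r}\,\mathcal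 D_\mu(f)\qquad(0\le r<1).$$ (2) Consequently, let $\omega:\mathbb D\to[0,\infty]$ be a superharmonic function (lower semicontinuous, not identically $+\infty$, and $\omega(w)\ge\frac1{2\pi}\int_0^{2\pi}\omega(w+\rho e^{i\theta})\,d\theta$ whenever $\rho>0$ and the closed disk of centre $w$ and radius $\rho$ lies in $\mathbb D$), and let $f\in\mathcal D_\omega$. Then $$\mathcal D_\omega(f_r)\le\frac{2r}{1+r}\,\mathcal D_\omega(f)\qquad(0\le r<1),$$ and in particular $\mathcal D_\omega(f_r)\le\mathcal D_\omega(f)$ for $0\le r<1$. -/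

import Mathlib

open MeasureTheory Metric Set
open scoped ENNReal

noncomputable section

/-- Normalized area measure `dA` on the open unit disk (total mass `1`). -/
def diskArea : Measure ℂ :=
  ENNReal.ofReal (1 / Real.pi) • (volume : Measure ℂ).restrict (ball (0 : ℂ) 1)

/-- The weighted Dirichlet integral `𝒟_ω(f) = ∫_𝔻 |f'|² ω dA ∈ [0,∞]`. -/
def dirichletIntegral (ω : ℂ → ℝ≥0∞) (f : ℂ → ℂ) : ℝ≥0∞ :=
  ∫⁻ z, ‖deriv f z‖ₑ ^ 2 * ω z ∂diskArea

/-- `f` belongs to the weighted Dirichlet space `𝒟_ω`: it is holomorphic on the open unit disk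
and its weighted Dirichlet integral is finite. -/
def MemDirichletSpace (ω : ℂ → ℝ≥0∞) (f : ℂ → ℂ) : Prop :=
  DifferentiableOn ℂ f (ball (0 : ℂ) 1) ∧ dirichletIntegral ω f < ∞

/-- The `r`-dilation `f_r(z) = f(rz)`. -/
def dilation (r : ℝ) (f : ℂ → ℂ) : ℂ → ℂ := fun z => f ((r : ℂ) * z)

/-- The normalized Green kernel `log |(1 - conj ζ z) / (ζ - z)| · 2 / (1 - |ζ|²)` of the unit disk,
for `ζ, z` in the open unit disk, with the value `+∞` at `z = ζ`. -/
def greenKernel (ζ z : ℂ) : ℝ≥0∞ :=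
  if z = ζ then ∞
  else ENNReal.ofReal
    (Real.log ‖(1 - (starRingEnd ℂ) ζ * z) / (ζ - z)‖ * (2 / (1 - ‖ζ‖ ^ 2)))

/-- The Poisson kernel `(1 - |z|²) / |ζ - z|²`, for `ζ` on the unit circle and `|z| < 1`. -/
def poissonKernelDisk (ζ z : ℂ) : ℝ≥0∞ :=
  ENNReal.ofReal ((1 - ‖z‖ ^ 2) / ‖ζ - z‖ ^ 2)

/-- The weight `ω` on the open unit disk represented by a measure `μ` on the closed unit disk:
the Green potential of the part of `μ` on the open disk plus the Poisson integral of the part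
of `μ` on the unit circle. -/
def measureWeight (μ : Measure (closedBall (0 : ℂ) 1)) (z : ℂ) : ℝ≥0∞ :=
  (∫⁻ ζ in {ζ : closedBall (0 : ℂ) 1 | ‖(ζ : ℂ)‖ < 1}, greenKernel ζ z ∂μ) +
    ∫⁻ ζ in {ζ : closedBall (0 : ℂ) 1 | ‖(ζ : ℂ)‖ = 1}, poissonKernelDisk ζ z ∂μ

/-- `ω` is a superharmonic weight: a positive (i.e. `[0,∞]`-valued) superharmonic function on the
open unit disk. That is, it is lower semicontinuous, not identically `+∞`, and satisfies the
super-mean-value inequality on every circle bounding a closed disk contained in the open unit disk.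
Values outside the open unit disk are irrelevant. -/
structure IsSuperharmonicWeight (ω : ℂ → ℝ≥0∞) : Prop where
  lowerSemicontinuousOn : LowerSemicontinuousOn ω (ball (0 : ℂ) 1)
  exists_ne_top : ∃ z ∈ ball (0 : ℂ) 1, ω z ≠ ∞
  circle_mean_le : ∀ (w : ℂ) (ρ : ℝ), 0 < ρ → closedBall w ρ ⊆ ball (0 : ℂ) 1 →
    ENNReal.ofReal (1 / (2 * Real.pi)) *
      (∫⁻ θ in Ioc (0 : ℝ) (2 * Real.pi), ω (circleMap w ρ θ)) ≤ ω w

end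

/-! The factor obtained is `r`, which is at most `2r/(1+r)`. For a polynomial `F`, let `P_F` be the
Poisson extension of `|F|²` minus `|F|²`. It vanishes on the circle and its Laplacian is `-4|F'|²`.
If `r P_F - P_{F_r}` is nonnegative on the disk, Green's formula against a superharmonic weight `W`
gives `∫ (r|F'|² - |F_r'|²) W ≥ 0`, which is the claim for `F`.

The positivity is pointwise. `P_F` equals `(1 - |z|²)` times the sum of the squared moduli of the
iterated backward shifts of `F` at `z` (`diskPotential_eq`), so the question is how that sum changes
under dilation. `sum_norm_tailSum_dilatedCoeff_le` settles it by an induction in which every defect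
is a sum of squares.

Green's formula is used in discrete form: the Laplacian is replaced by `Φ` minus its mean over
circles of radius `ρ`, an operator that is symmetric by Fubini. The weight then needs only
measurability, boundedness and the super-mean-value inequality
(`setIntegral_sub_circleAverage_nonneg`). Letting `ρ → 0` recovers `|F'|²`. Limits then pass from
polynomials to functions holomorphic past the closed disk, to all holomorphic functions by scaling,
and to unbounded weights by truncation.

Both halves of the theorem are instances of this: superharmonic weights have the super-mean-value
property by definition, and the weights of measures inherit it from the Green and Poisson kernels.
No Riesz representation is needed. -/

noncomputable section

/-! ### Backward shifts of a polynomial and of its dilation. -/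

/-- The section `∑_{k ≤ n < N} aₙ z^(n-k)` of a polynomial; it is the polynomial itself for `k = 0`
and an iterated backward shift of it in general. -/
def tailSum (a : ℕ → ℂ) (N k : ℕ) (z : ℂ) : ℂ :=
  ∑ n ∈ Finset.Ico k N, a n * z ^ (n - k)

theorem tailSum_of_le {a : ℕ → ℂ} {N k : ℕ} (h : N ≤ k) (z : ℂ) : tailSum a N k z = 0 := by
  simp [tailSum, Finset.Ico_eq_empty_of_le h]

theorem tailSum_eq_add {a : ℕ → ℂ} {N k : ℕ} (h : k < N) (z : ℂ) :
    tailSum a N k z = a k + z * tailSum a N (k + 1) z := by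
  rw [tailSum, Finset.sum_eq_sum_Ico_succ_bot h, tailSum, Finset.mul_sum]
  congr 1
  · simp
  · refine Finset.sum_congr rfl fun n hn => ?_
    rw [Finset.mem_Ico] at hn
    rw [show n - k = (n - (k + 1)) + 1 by omega, pow_succ]
    ring

theorem tailSum_zero (a : ℕ → ℂ) (N : ℕ) (z : ℂ) :
    tailSum a N 0 z = ∑ n ∈ Finset.range N, a n * z ^ n := by
  simp [tailSum]

theorem differentiable_tailSum (a : ℕ → ℂ) (N k : ℕ) : Differentiable ℂ (tailSum a N k) := by
  unfold tailSum
  fun_prop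

/-- The coefficients of the dilation of a polynomial. -/
def dilatedCoeff (r : ℝ) (a : ℕ → ℂ) (n : ℕ) : ℂ := (r : ℂ) ^ n * a n

theorem tailSum_dilatedCoeff_zero (r : ℝ) (a : ℕ → ℂ) (N : ℕ) (z : ℂ) :
    tailSum (dilatedCoeff r a) N 0 z = tailSum a N 0 (r * z) := by
  simp only [tailSum_zero, dilatedCoeff, mul_pow]
  exact Finset.sum_congr rfl fun n _ => by ring

/-- Both sides are the `k`-th coefficient of the dilation. This recursion is all that the comparison
uses about the two families of tails. -/
theorem pow_mul_tailSum_sub (r : ℝ) (a : ℕ → ℂ) (N : ℕ) (z : ℂ) (k : ℕ) :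
    (r : ℂ) ^ k * (tailSum a N k z - z * tailSum a N (k + 1) z) =
      tailSum (dilatedCoeff r a) N k z - z * tailSum (dilatedCoeff r a) N (k + 1) z := by
  rcases lt_or_ge k N with h | h
  · rw [tailSum_eq_add h, tailSum_eq_add h, dilatedCoeff]
    ring
  · simp [tailSum_of_le h, tailSum_of_le (h.trans k.le_succ)]

/-- The dual sequence used to test the inequality between the tails of a polynomial and those of
its dilation. -/
def dualSeq (z : ℂ) (W : ℕ → ℂ) : ℕ → ℂ
  | 0 => 0
  | k + 1 => (starRingEnd ℂ) z * dualSeq z W k + W (k + 1)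

/-- Here `q` stands for `r ^ k`. With `b = conj z * S` and `s = b + W`, right side minus left side
is exactly `‖rV - q(rs - b)‖² + (1-r) q² r (1 - r‖z‖²) ‖s‖² + r (1 - q²) ‖W‖²`. -/
theorem dual_step {r q : ℝ} (hr : 0 ≤ r) (hr1 : r ≤ 1) (hq : 0 ≤ q) (hq1 : q ≤ 1)
    {z S V V' W W' : ℂ} (hz : ‖z‖ ≤ 1) (h : (q * r : ℂ) * (V - z * V') = W - z * W') :
    2 * r * (z * (starRingEnd ℂ) ((starRingEnd ℂ) z * S + W) * ((q * r) * V' - W')).re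
        + (1 - r) * (q * r) ^ 2 * ‖z‖ ^ 2 * ‖(starRingEnd ℂ) z * S + W‖ ^ 2
      ≤ 2 * r * (z * (starRingEnd ℂ) S * (q * V - W)).re
        + (1 - r) * q ^ 2 * ‖z‖ ^ 2 * ‖S‖ ^ 2 + r * (r * ‖V‖ ^ 2 - ‖W‖ ^ 2) := by
  set b := (starRingEnd ℂ) z * S with hb
  set s := b + W with hs
  have hzb : z * (starRingEnd ℂ) S = (starRingEnd ℂ) b := by simp [hb]
  -- The recursion `h` says `z (q r V' - W') = q r V - W`, which removes `V'` and `W'`.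
  have e1 : z * (starRingEnd ℂ) s * ((q * r) * V' - W') = (starRingEnd ℂ) s * (q * r * V - W) := by
    linear_combination (-(starRingEnd ℂ) s) * h
  have hbn : ‖b‖ ^ 2 = ‖z‖ ^ 2 * ‖S‖ ^ 2 := by simp [hb, mul_pow]
  have key : 0 ≤ ‖(r : ℂ) * V - q * (r * s - b)‖ ^ 2 := by positivity
  have hz2 : ‖z‖ ^ 2 ≤ 1 := pow_le_one₀ (norm_nonneg _) hz
  have hrz : 0 ≤ (1 - r) * q ^ 2 * r * (1 - r * ‖z‖ ^ 2) * ‖s‖ ^ 2 := by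
    have : r * ‖z‖ ^ 2 ≤ 1 := mul_le_one₀ hr1 (by positivity) hz2
    have h1 : 0 ≤ 1 - r := by linarith
    have h2 : 0 ≤ 1 - r * ‖z‖ ^ 2 := by linarith
    positivity
  have hqW : 0 ≤ r * (1 - q ^ 2) * ‖W‖ ^ 2 := by
    have : q ^ 2 ≤ 1 := pow_le_one₀ hq hq1
    have h1 : 0 ≤ 1 - q ^ 2 := by linarith
    positivity
  rw [e1, hzb]
  have hsplit : (1 - r) * q ^ 2 * ‖z‖ ^ 2 * ‖S‖ ^ 2 = (1 - r) * q ^ 2 * ‖b‖ ^ 2 := by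
    rw [hbn]; ring
  rw [hsplit]
  have hW : W = s - b := by rw [hs]; ring
  clear_value s b
  subst hW
  rw [← sub_nonneg]
  refine (add_nonneg (add_nonneg key hrz) hqW).trans_eq ?_
  simp only [← Complex.normSq_eq_norm_sq, Complex.normSq_apply, Complex.sub_re, Complex.sub_im,
    Complex.mul_re, Complex.mul_im, Complex.ofReal_re, Complex.ofReal_im, Complex.conj_re,
    Complex.conj_im]
  ring

/-- Telescoped form of `dual_step`. The left side is the boundary term of a summation by parts plus
a nonnegative square carried along the induction. -/
theorem dualSeq_inequality {r : ℝ} (hr : 0 ≤ r) (hr1 : r ≤ 1) {z : ℂ} (hz : ‖z‖ ≤ 1)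
    {V W : ℕ → ℂ} (h : ∀ k, (r : ℂ) ^ k * (V k - z * V (k + 1)) = W k - z * W (k + 1)) (K : ℕ) :
    2 * r * (z * (starRingEnd ℂ) (dualSeq z W K) * ((r : ℂ) ^ K * V (K + 1) - W (K + 1))).re
        + (1 - r) * (r ^ K) ^ 2 * ‖z‖ ^ 2 * ‖dualSeq z W K‖ ^ 2
      ≤ r * ∑ k ∈ Finset.range K, (r * ‖V (k + 1)‖ ^ 2 - ‖W (k + 1)‖ ^ 2) := by
  induction K with
  | zero => simp [dualSeq]
  | succ K ih =>
    have := dual_step hr hr1 (pow_nonneg hr K) (pow_le_one₀ hr hr1) (S := dualSeq z W K) hz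
      (V := V (K + 1)) (V' := V (K + 2)) (W := W (K + 1)) (W' := W (K + 2))
      (by have := h (K + 1); push_cast; rwa [pow_succ] at this)
    rw [Finset.sum_range_succ, mul_add]
    simp only [dualSeq]
    push_cast at this
    rw [pow_succ (r : ℂ) K, pow_succ r K]
    linarith

theorem sum_norm_tailSum_dilatedCoeff_le {r : ℝ} (hr : 0 < r) (hr1 : r ≤ 1) (a : ℕ → ℂ) (N : ℕ)
    {z : ℂ} (hz : ‖z‖ ≤ 1) :
    ∑ k ∈ Finset.range N, ‖tailSum (dilatedCoeff r a) N (k + 1) z‖ ^ 2 ≤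
      r * ∑ k ∈ Finset.range N, ‖tailSum a N (k + 1) z‖ ^ 2 := by
  -- At `K = N` the tails of index `N + 1` vanish, so only the nonnegative square remains on the
  -- left.
  have h := dualSeq_inequality hr.le hr1 hz (pow_mul_tailSum_sub r a N z) N
  rw [tailSum_of_le N.le_succ, tailSum_of_le N.le_succ, Finset.sum_sub_distrib,
    ← Finset.mul_sum] at h
  have h1 : 0 ≤ 1 - r := by linarith
  have h2 : 0 ≤ (1 - r) * (r ^ N) ^ 2 * ‖z‖ ^ 2 *
      ‖dualSeq z (fun k => tailSum (dilatedCoeff r a) N k z) N‖ ^ 2 := by positivity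
  simp only [mul_zero, sub_zero, Complex.zero_re, zero_add] at h
  have := nonneg_of_mul_nonneg_right (h2.trans h) hr
  linarith

/-! ### The potential of a polynomial and its circle means. -/

/-- The Poisson extension of `|F|²` minus `|F|²`, for a polynomial `F`. -/
def diskPotential (a : ℕ → ℂ) (N : ℕ) (z : ℂ) : ℝ :=
  ∑ k ∈ Finset.range N, (2 * ((starRingEnd ℂ) (a k) * tailSum a N k z).re - ‖a k‖ ^ 2) -
    ‖tailSum a N 0 z‖ ^ 2

/-- Since `tail_k - a_k = z * tail_{k+1}`, expanding `‖tail_k - a_k‖²` gives a telescoping sum. The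
harmonic part of `diskPotential` comes from pairing the terms `(k, n)` and `(n, k)` of `|F|²` on the
circle. -/
theorem diskPotential_eq (a : ℕ → ℂ) (N : ℕ) (z : ℂ) :
    diskPotential a N z =
      (1 - ‖z‖ ^ 2) * ∑ k ∈ Finset.range N, ‖tailSum a N (k + 1) z‖ ^ 2 := by
  have key : ∀ k ∈ Finset.range N, ‖z‖ ^ 2 * ‖tailSum a N (k + 1) z‖ ^ 2 =
      ‖tailSum a N k z‖ ^ 2 -
        (2 * ((starRingEnd ℂ) (a k) * tailSum a N k z).re - ‖a k‖ ^ 2) := by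
    intro k hk
    rw [tailSum_eq_add (Finset.mem_range.1 hk)]
    simp only [← Complex.normSq_eq_norm_sq, Complex.normSq_apply, Complex.add_re, Complex.add_im,
      Complex.mul_re, Complex.mul_im, Complex.conj_re, Complex.conj_im]
    ring
  have tel := Finset.sum_range_sub (fun k => ‖tailSum a N k z‖ ^ 2) N
  rw [Finset.sum_sub_distrib, tailSum_of_le le_rfl] at tel
  rw [sub_mul, one_mul, Finset.mul_sum, Finset.sum_congr rfl key, Finset.sum_sub_distrib,
    diskPotential]
  simp only [norm_zero] at tel
  linarith

theorem continuous_diskPotential (a : ℕ → ℂ) (N : ℕ) : Continuous (diskPotential a N) := by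
  have := fun k => (differentiable_tailSum a N k).continuous
  unfold diskPotential
  fun_prop

theorem diskPotential_dilatedCoeff_le {r : ℝ} (hr : 0 < r) (hr1 : r ≤ 1) (a : ℕ → ℂ) (N : ℕ)
    {z : ℂ} (hz : ‖z‖ ≤ 1) :
    diskPotential (dilatedCoeff r a) N z ≤ r * diskPotential a N z := by
  rw [diskPotential_eq, diskPotential_eq, mul_left_comm]
  have : ‖z‖ ^ 2 ≤ 1 := pow_le_one₀ (norm_nonneg _) hz
  exact mul_le_mul_of_nonneg_left (sum_norm_tailSum_dilatedCoeff_le hr hr1 a N hz) (by linarith)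

theorem circleIntegrable_of_continuous {E : Type*} [NormedAddCommGroup E] {g : ℂ → E}
    (hg : Continuous g) (w : ℂ) (ρ : ℝ) : CircleIntegrable g w ρ :=
  (hg.comp (continuous_circleMap w ρ)).intervalIntegrable _ _

theorem circleAverage_re_of_differentiable {g : ℂ → ℂ} (hg : Differentiable ℂ g) (w : ℂ) (ρ : ℝ) :
    Real.circleAverage (fun z => (g z).re) w ρ = (g w).re := by
  have h := Complex.reCLM.circleAverage_comp_comm (f := g) (c := w) (R := ρ)
    (circleIntegrable_of_continuous hg.continuous w ρ)
  rw [hg.diffContOnCl.circleAverage] at h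
  exact h

theorem circleAverage_norm_sq_sub {g : ℂ → ℂ} (hg : Differentiable ℂ g) (w : ℂ) (ρ : ℝ) :
    Real.circleAverage (fun z => ‖g z - g w‖ ^ 2) w ρ =
      Real.circleAverage (fun z => ‖g z‖ ^ 2) w ρ - ‖g w‖ ^ 2 := by
  have hc := hg.continuous
  have e : (fun z => ‖g z - g w‖ ^ 2) =
      fun z => (‖g z‖ ^ 2 - 2 * ((starRingEnd ℂ) (g w) * g z).re) + ‖g w‖ ^ 2 := by
    funext z
    simp only [← Complex.normSq_eq_norm_sq, Complex.normSq_apply, Complex.sub_re, Complex.sub_im,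
      Complex.mul_re, Complex.conj_re, Complex.conj_im]
    ring
  have e2 : (fun z => 2 * ((starRingEnd ℂ) (g w) * g z).re) =
      fun z => (2 * ((starRingEnd ℂ) (g w) * g z)).re := by
    funext z; simp
  rw [e, Real.circleAverage_fun_add (circleIntegrable_of_continuous (by fun_prop) _ _)
      (circleIntegrable_of_continuous (by fun_prop) _ _),
    Real.circleAverage_fun_sub (circleIntegrable_of_continuous (by fun_prop) _ _)
      (circleIntegrable_of_continuous (by fun_prop) _ _), Real.circleAverage_const, e2,
    circleAverage_re_of_differentiable (by fun_prop)]
  simp only [← Complex.normSq_eq_norm_sq, Complex.normSq_apply,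
      Complex.mul_re, Complex.mul_im, Complex.conj_re, Complex.conj_im, Complex.re_ofNat,
      Complex.im_ofNat]
  ring

/-- The harmonic part is the real part of a polynomial and is preserved by the mean; `-|F|²`
contributes minus the variance of `F` on the circle. -/
theorem circleAverage_diskPotential (a : ℕ → ℂ) (N : ℕ) (w : ℂ) (ρ : ℝ) :
    Real.circleAverage (diskPotential a N) w ρ = diskPotential a N w -
      Real.circleAverage (fun z => ‖tailSum a N 0 z - tailSum a N 0 w‖ ^ 2) w ρ := by
  have hd := differentiable_tailSum a N
  have hc := fun k => (hd k).continuous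
  set G : ℂ → ℂ := fun z =>
    ∑ k ∈ Finset.range N, (2 * ((starRingEnd ℂ) (a k) * tailSum a N k z) - (‖a k‖ ^ 2 : ℝ)) with hG
  have hGd : Differentiable ℂ G := by fun_prop
  have e : diskPotential a N = fun z => (G z).re - ‖tailSum a N 0 z‖ ^ 2 := by
    funext z
    simp [diskPotential, hG, -Complex.ofReal_pow]
  rw [circleAverage_norm_sq_sub (hd 0), e,
    Real.circleAverage_fun_sub (f₁ := fun z => (G z).re) (circleIntegrable_of_continuous
      (Complex.continuous_re.comp hGd.continuous) _ _)
      (circleIntegrable_of_continuous (by fun_prop) _ _),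
    circleAverage_re_of_differentiable hGd]
  ring

theorem circleAverage_norm_sq (w : ℂ) (ρ : ℝ) :
    Real.circleAverage (fun z : ℂ => ‖z‖ ^ 2) w ρ = ‖w‖ ^ 2 + ρ ^ 2 := by
  have h := circleAverage_norm_sq_sub differentiable_id w ρ
  have h2 : Real.circleAverage (fun z : ℂ => ‖id z - id w‖ ^ 2) w ρ = ρ ^ 2 := by
    apply Real.circleAverage_const_on_circle
    intro z hz
    rw [mem_sphere, dist_eq_norm] at hz
    simp [hz]
  rw [h2] at h
  simp only [id] at h
  linarith

/-! ### Symmetry of the circle-mean operator. -/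

theorem integrable_of_bounded_of_support {u : ℂ → ℝ} {B t : ℝ} (hu : Measurable u)
    (hB : ∀ z, ‖u z‖ ≤ B) (ht : ∀ z, t < ‖z‖ → u z = 0) : Integrable u := by
  have hi : Integrable ((closedBall (0 : ℂ) t).indicator fun _ => B) :=
    (integrableOn_const (measure_closedBall_lt_top).ne).integrable_indicator
      measurableSet_closedBall
  refine hi.mono' hu.aestronglyMeasurable (Filter.Eventually.of_forall fun z => ?_)
  by_cases hz : z ∈ closedBall (0 : ℂ) t
  · rw [indicator_of_mem hz]; exact hB z
  · rw [indicator_of_notMem hz, ht z (by simpa using hz), norm_zero]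

theorem integrable_prod_of_bounded_of_support {G : ℂ × ℝ → ℝ} {B t : ℝ} {ν : Measure ℝ}
    [IsFiniteMeasure ν] (hG : Measurable G) (hB : ∀ p, ‖G p‖ ≤ B)
    (ht : ∀ p : ℂ × ℝ, t < ‖p.1‖ → G p = 0) : Integrable G (volume.prod ν) := by
  have hi : Integrable ((closedBall (0 : ℂ) t).indicator fun _ => B) :=
    (integrableOn_const (measure_closedBall_lt_top).ne).integrable_indicator
      measurableSet_closedBall
  refine (hi.comp_fst ν).mono' hG.aestronglyMeasurable (Filter.Eventually.of_forall fun p => ?_)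
  by_cases hz : p.1 ∈ closedBall (0 : ℂ) t
  · rw [indicator_of_mem hz]; exact hB p
  · rw [indicator_of_notMem hz, ht p (by simpa using hz), norm_zero]

theorem circleIntegrable_of_measurable_of_bounded {u : ℂ → ℝ} {B : ℝ} (hu : Measurable u)
    (hB : ∀ z, ‖u z‖ ≤ B) (w : ℂ) (ρ : ℝ) : CircleIntegrable u w ρ := by
  refine (intervalIntegrable_const (c := B)).mono_fun'
    (hu.comp (continuous_circleMap w ρ).measurable).aestronglyMeasurable
    (Filter.Eventually.of_forall fun θ => hB _)

theorem circleAverage_eq_setIntegral (u : ℂ → ℝ) (w : ℂ) (ρ : ℝ) :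
    Real.circleAverage u w ρ =
      (2 * Real.pi)⁻¹ * ∫ θ in Ioc 0 (2 * Real.pi), u (circleMap w ρ θ) := by
  rw [Real.circleAverage_def, intervalIntegral.integral_of_le Real.two_pi_pos.le, smul_eq_mul]

theorem measurable_circleMap_uncurry (ρ : ℝ) :
    Measurable fun p : ℂ × ℝ => circleMap p.1 ρ p.2 := by
  unfold circleMap
  fun_prop

theorem norm_le_norm_circleMap_add (w : ℂ) (ρ θ : ℝ) : ‖w‖ ≤ ‖circleMap w ρ θ‖ + |ρ| := by
  have h : w = circleMap w ρ θ - circleMap 0 ρ θ := by simp [circleMap]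
  calc ‖w‖ = ‖circleMap w ρ θ - circleMap 0 ρ θ‖ := by rw [← h]
    _ ≤ ‖circleMap w ρ θ‖ + ‖circleMap 0 ρ θ‖ := norm_sub_le _ _
    _ = _ := by simp [norm_circleMap_zero]

section Fubini

variable {u W : ℂ → ℝ} {B C t : ℝ}

theorem integrable_circleMap_mul (hu : Measurable u) (hB : ∀ z, ‖u z‖ ≤ B)
    (ht : ∀ z, t < ‖z‖ → u z = 0) (hW : Measurable W) (hC : ∀ z, ‖W z‖ ≤ C) (ρ : ℝ) :
    Integrable (fun p : ℂ × ℝ => u (circleMap p.1 ρ p.2) * W p.1)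
      (volume.prod (volume.restrict (Ioc 0 (2 * Real.pi)))) := by
  refine integrable_prod_of_bounded_of_support (B := B * C) (t := t + |ρ|)
    ((hu.comp (measurable_circleMap_uncurry ρ)).mul (hW.comp measurable_fst)) (fun p => ?_)
    fun p hp => ?_
  · rw [norm_mul]
    exact mul_le_mul (hB _) (hC _) (norm_nonneg _) ((norm_nonneg _).trans (hB 0))
  · rw [ht, zero_mul]
    linarith [norm_le_norm_circleMap_add p.1 ρ p.2]

theorem integrable_circleAverage_mul (hu : Measurable u) (hB : ∀ z, ‖u z‖ ≤ B)
    (ht : ∀ z, t < ‖z‖ → u z = 0) (hW : Measurable W) (hC : ∀ z, ‖W z‖ ≤ C) (ρ : ℝ) :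
    Integrable fun z => Real.circleAverage u z ρ * W z := by
  have h := (integrable_circleMap_mul hu hB ht hW hC ρ).integral_prod_left.const_mul
    (2 * Real.pi)⁻¹
  refine h.congr (Filter.Eventually.of_forall fun z => ?_)
  simp only [circleAverage_eq_setIntegral, integral_mul_const]
  ring

theorem integral_circleAverage_mul_comm (hu : Measurable u) (hB : ∀ z, ‖u z‖ ≤ B)
    (ht : ∀ z, t < ‖z‖ → u z = 0) (hW : Measurable W) (hC : ∀ z, ‖W z‖ ≤ C) (ρ : ℝ) :
    ∫ z, Real.circleAverage u z ρ * W z = ∫ z, Real.circleAverage W z ρ * u z := by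
  have h1 : Integrable (fun p : ℂ × ℝ => W (circleMap p.1 ρ p.2) * u p.1)
      (volume.prod (volume.restrict (Ioc 0 (2 * Real.pi)))) := by
    refine integrable_prod_of_bounded_of_support (B := C * B) (t := t)
      ((hW.comp (measurable_circleMap_uncurry ρ)).mul (hu.comp measurable_fst)) (fun p => ?_)
      fun p hp => ?_
    · rw [norm_mul]
      exact mul_le_mul (hC _) (hB _) (norm_nonneg _) ((norm_nonneg _).trans (hC 0))
    · rw [ht _ hp, mul_zero]
  -- The radius `-ρ` leaves the mean unchanged and makes translation by `circleMap 0 ρ θ` carry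
  -- `circleMap z (-ρ) θ` back to `z`.
  have h2 := integrable_circleMap_mul hu hB ht hW hC (-ρ)
  calc ∫ z, Real.circleAverage u z ρ * W z
      = (2 * Real.pi)⁻¹ * ∫ z, ∫ θ in Ioc 0 (2 * Real.pi), u (circleMap z (-ρ) θ) * W z := by
        rw [← integral_const_mul]
        refine integral_congr_ae (Filter.Eventually.of_forall fun z => ?_)
        simp only
        rw [← Real.circleAverage_neg_radius, circleAverage_eq_setIntegral, integral_mul_const,
          mul_assoc]
    _ = (2 * Real.pi)⁻¹ * ∫ θ in Ioc 0 (2 * Real.pi), ∫ z, u (circleMap z (-ρ) θ) * W z := by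
        rw [integral_integral_swap h2]
    _ = (2 * Real.pi)⁻¹ * ∫ θ in Ioc 0 (2 * Real.pi), ∫ z, W (circleMap z ρ θ) * u z := by
        congr 1
        refine integral_congr_ae (Filter.Eventually.of_forall fun θ => ?_)
        simp only
        rw [← integral_add_right_eq_self _ (circleMap 0 ρ θ)]
        refine integral_congr_ae (Filter.Eventually.of_forall fun z => ?_)
        simp only [circleMap, zero_add]
        rw [mul_comm]
        congr 2
        push_cast
        ring
    _ = (2 * Real.pi)⁻¹ * ∫ z, ∫ θ in Ioc 0 (2 * Real.pi), W (circleMap z ρ θ) * u z := by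
        rw [integral_integral_swap (f := fun z θ => W (circleMap z ρ θ) * u z) h1]
    _ = ∫ z, Real.circleAverage W z ρ * u z := by
        rw [← integral_const_mul]
        refine integral_congr_ae (Filter.Eventually.of_forall fun z => ?_)
        simp only
        rw [circleAverage_eq_setIntegral, integral_mul_const, mul_assoc]

theorem integral_circleAverage_mul_le (hu : Measurable u) (hu0 : ∀ z, 0 ≤ u z)
    (hB : ∀ z, ‖u z‖ ≤ B) (ht : ∀ z, t < ‖z‖ → u z = 0) (hW : Measurable W)
    (hC : ∀ z, ‖W z‖ ≤ C) (ρ : ℝ) (hmean : ∀ w, ‖w‖ ≤ t → Real.circleAverage W w ρ ≤ W w) :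
    ∫ z, Real.circleAverage u z ρ * W z ≤ ∫ z, u z * W z := by
  rw [integral_circleAverage_mul_comm hu hB ht hW hC]
  have hi : ∀ z, ‖Real.circleAverage W z ρ‖ ≤ C := fun z => by
    rw [Real.norm_eq_abs]
    refine Real.abs_circleAverage_le_circleAverage_abs.trans
      (Real.circleAverage_mono_on_of_le_circle ?_ fun x _ => hC x)
    exact circleIntegrable_of_measurable_of_bounded (B := C) hW.norm (by simpa using hC) z ρ
  have hm : Measurable fun z => Real.circleAverage W z ρ := by
    simp only [circleAverage_eq_setIntegral]
    exact (StronglyMeasurable.integral_prod_right'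
      (hW.comp (measurable_circleMap_uncurry ρ)).stronglyMeasurable).measurable.const_mul _
  refine integral_mono ?_ ?_ fun z => ?_
  · refine integrable_of_bounded_of_support (B := C * B) (t := t) (hm.mul hu) (fun z => ?_)
      fun z hz => by rw [ht z hz, mul_zero]
    rw [norm_mul]
    exact mul_le_mul (hi _) (hB _) (norm_nonneg _) ((norm_nonneg _).trans (hC 0))
  · refine integrable_of_bounded_of_support (B := B * C) (t := t) (hu.mul hW) (fun z => ?_)
      fun z hz => by rw [ht z hz, zero_mul]
    rw [norm_mul]
    exact mul_le_mul (hB _) (hC _) (norm_nonneg _) ((norm_nonneg _).trans (hB 0))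
  · simp only
    rcases le_or_gt ‖z‖ t with hz | hz
    · rw [mul_comm (u z)]
      exact mul_le_mul_of_nonneg_right (hmean z hz) (hu0 z)
    · simp [ht z hz]

end Fubini

/-! ### Discrete Green inequality on superlevel sets. -/

theorem continuous_circleAverage_center {Φ : ℂ → ℝ} (hΦ : Continuous Φ) (ρ : ℝ) :
    Continuous fun z => Real.circleAverage Φ z ρ := by
  refine (intervalIntegral.continuous_parametric_intervalIntegral_of_continuous' (μ := volume)
    (f := fun z θ => Φ (circleMap z ρ θ)) ?_ _ _).const_smul (2 * Real.pi)⁻¹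
  have : Continuous fun p : ℂ × ℝ => circleMap p.1 ρ p.2 := by
    unfold circleMap; fun_prop
  exact hΦ.comp this

/-- The region of the disk on which `Φ` exceeds the level `ε`. -/
def superlevel (Φ : ℂ → ℝ) (ε : ℝ) : Set ℂ := {z | ‖z‖ < 1 ∧ ε < Φ z}

theorem measurableSet_superlevel {Φ : ℂ → ℝ} (hΦ : Continuous Φ) (ε : ℝ) :
    MeasurableSet (superlevel Φ ε) :=
  ((isOpen_lt continuous_norm continuous_const).inter
    (isOpen_lt continuous_const hΦ)).measurableSet

theorem superlevel_subset_ball (Φ : ℂ → ℝ) (ε : ℝ) : superlevel Φ ε ⊆ ball 0 1 :=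
  fun z hz => by simpa using hz.1

theorem integrableOn_continuous_mul {Φ W : ℂ → ℝ} {C : ℝ} (hΦ : Continuous Φ) (hW : Measurable W)
    (hC : ∀ z, ‖W z‖ ≤ C) {s : Set ℂ} (hs : s ⊆ ball 0 1) :
    IntegrableOn (fun z => Φ z * W z) s := by
  refine IntegrableOn.mono_set ?_ (hs.trans ball_subset_closedBall)
  exact (hΦ.continuousOn.integrableOn_compact (isCompact_closedBall (0 : ℂ) 1)).mul_bdd
    hW.aestronglyMeasurable (Filter.Eventually.of_forall hC)

/-- Compactness keeps the superlevel set away from the circle, so that all sufficiently small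
circles centred in it stay in the disk. -/
theorem exists_superlevel_subset {Φ : ℂ → ℝ} (hΦ : Continuous Φ)
    (hbd : ∀ z, ‖z‖ = 1 → Φ z ≤ 0) {ε : ℝ} (hε : 0 < ε) :
    ∃ t, t < 1 ∧ superlevel Φ ε ⊆ closedBall 0 t := by
  have hK : IsCompact (closedBall (0 : ℂ) 1 ∩ {z | ε ≤ Φ z}) :=
    (isCompact_closedBall 0 1).inter_right (isClosed_le continuous_const hΦ)
  have hsub : superlevel Φ ε ⊆ closedBall (0 : ℂ) 1 ∩ {z | ε ≤ Φ z} :=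
    fun z hz => ⟨by simpa using hz.1.le, hz.2.le⟩
  rcases (closedBall (0 : ℂ) 1 ∩ {z | ε ≤ Φ z}).eq_empty_or_nonempty with he | hne
  · exact ⟨0, one_pos, fun z hz => absurd (hsub hz) (by simp [he])⟩
  · obtain ⟨z₀, hz₀, hmax⟩ := hK.exists_isMaxOn hne continuous_norm.continuousOn
    refine ⟨‖z₀‖, lt_of_le_of_ne (by simpa using hz₀.1) fun h => ?_, fun z hz => ?_⟩
    · have h1 : ε ≤ Φ z₀ := hz₀.2
      linarith [hbd z₀ h]
    · simpa using hmax (hsub hz)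

/-- If `Φ` is continuous with nonpositive boundary values and `W` is superharmonic on circles,
the discrete Laplacian of `Φ` pairs with `W` with a definite sign over superlevel sets. -/
theorem setIntegral_sub_circleAverage_nonneg {Φ W : ℂ → ℝ} {C : ℝ} (hΦ : Continuous Φ)
    (hbd : ∀ z, ‖z‖ = 1 → Φ z ≤ 0) (hW : Measurable W) (hW0 : ∀ z, 0 ≤ W z)
    (hC : ∀ z, ‖W z‖ ≤ C)
    (hmean : ∀ w ρ, 0 < ρ → closedBall w ρ ⊆ ball (0 : ℂ) 1 → Real.circleAverage W w ρ ≤ W w)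
    {ε : ℝ} (hε : 0 < ε) :
    ∃ ρ₀ > 0, ∀ ρ, 0 < ρ → ρ < ρ₀ →
      0 ≤ ∫ z in superlevel Φ ε, (Φ z - Real.circleAverage Φ z ρ) * W z := by
  obtain ⟨t, ht1, htsub⟩ := exists_superlevel_subset hΦ hbd hε
  refine ⟨1 - t, by linarith, fun ρ hρ hρt => ?_⟩
  -- The cutoff `(Φ - ε)⁺`, extended by zero, is nonnegative with compact support in the disk, so
  -- symmetry and the super-mean-value inequality give `∫ (u - mean u) W ≥ 0`.
  set u : ℂ → ℝ := (ball (0 : ℂ) 1).indicator fun z => max (Φ z - ε) 0 with hu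
  have hum : Measurable u :=
    ((hΦ.sub continuous_const).max continuous_const).measurable.indicator measurableSet_ball
  have hu0 : ∀ z, 0 ≤ u z := fun z => indicator_nonneg (fun _ _ => le_max_right _ _) z
  have hball : ∀ w, ‖w‖ ≤ t → closedBall w ρ ⊆ ball (0 : ℂ) 1 := fun w hw =>
    closedBall_subset_ball' (by rw [dist_zero_right]; linarith)
  have huK : ∀ z, z ∉ superlevel Φ ε → u z = 0 := fun z hz => by
    by_cases hzb : z ∈ ball (0 : ℂ) 1
    · rw [hu, indicator_of_mem hzb, max_eq_right]
      by_contra hlt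
      exact hz ⟨by simpa using hzb, by linarith⟩
    · exact indicator_of_notMem hzb _
  have hut : ∀ z, t < ‖z‖ → u z = 0 := fun z hz =>
    huK z fun hzK => by have := htsub hzK; simp at this; linarith
  obtain ⟨B, hB⟩ := (isCompact_closedBall (0 : ℂ) 1).exists_bound_of_continuousOn
    ((hΦ.sub continuous_const).max continuous_const).continuousOn (f := fun z => max (Φ z - ε) 0)
  have huB : ∀ z, ‖u z‖ ≤ B := fun z => by
    by_cases hzb : z ∈ ball (0 : ℂ) 1
    · rw [hu, indicator_of_mem hzb]; exact hB z (ball_subset_closedBall hzb)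
    · rw [hu, indicator_of_notMem hzb, norm_zero]
      exact (norm_nonneg _).trans (hB 0 (by simp))
  have hle := integral_circleAverage_mul_le hum hu0 huB hut hW hC ρ
    fun w hw => hmean w ρ hρ (hball w hw)
  have hi1 := integrable_circleAverage_mul hum huB hut hW hC ρ
  have hi2 : Integrable fun z => u z * W z :=
    integrable_of_bounded_of_support (B := B * C) (t := t) (hum.mul hW) (fun z => by
      rw [norm_mul]
      exact mul_le_mul (huB _) (hC _) (norm_nonneg _) ((norm_nonneg _).trans (huB 0)))
      fun z hz => by rw [hut z hz, zero_mul]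
  have hKm := measurableSet_superlevel hΦ ε
  have hi3 : IntegrableOn (fun z => (Φ z - Real.circleAverage Φ z ρ) * W z) (superlevel Φ ε) :=
    integrableOn_continuous_mul (hΦ.sub (continuous_circleAverage_center hΦ ρ)) hW hC
      (superlevel_subset_ball Φ ε)
  have h0 : 0 ≤ ∫ z, (u z * W z - Real.circleAverage u z ρ * W z) := by
    rw [integral_sub hi2 hi1]; linarith
  rw [← integral_indicator hKm]
  -- Pointwise comparison: on the superlevel set `u = Φ - ε` while `mean u ≥ mean Φ - ε`; off it `u
  -- = 0` and `mean u ≥ 0`.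
  refine h0.trans (integral_mono (hi2.sub hi1) (hi3.integrable_indicator hKm) fun z => ?_)
  by_cases hz : z ∈ superlevel Φ ε
  · simp only [indicator_of_mem hz, ← sub_mul]
    refine mul_le_mul_of_nonneg_right ?_ (hW0 z)
    have huz : u z = Φ z - ε := by
      rw [hu, indicator_of_mem (superlevel_subset_ball _ _ hz), max_eq_left]
      linarith [hz.2]
    have hav : Real.circleAverage (fun z => Φ z - ε) z ρ ≤ Real.circleAverage u z ρ := by
      refine Real.circleAverage_mono (circleIntegrable_of_continuous (by fun_prop) _ _)
        (circleIntegrable_of_measurable_of_bounded hum huB _ _) fun x hx => ?_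
      rw [abs_of_pos hρ] at hx
      rw [hu, indicator_of_mem (hball z (by simpa using htsub hz) (sphere_subset_closedBall hx))]
      exact le_max_left _ _
    rw [Real.circleAverage_fun_sub (circleIntegrable_of_continuous hΦ _ _)
      (circleIntegrable_of_continuous continuous_const _ _), Real.circleAverage_const] at hav
    linarith
  · simp only [indicator_of_notMem hz, huK z hz, zero_mul, zero_sub, Left.neg_nonpos_iff]
    exact mul_nonneg (Real.circleAverage_nonneg_of_nonneg fun x _ => hu0 x) (hW0 z)

/-! ### Small-circle variance converges to the squared derivative. -/

theorem inv_sq_mul_circleAverage_eq {g : ℂ → ℂ} (w : ℂ) {ρ : ℝ} (hρ : ρ ≠ 0) :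
    (ρ ^ 2)⁻¹ * Real.circleAverage (fun z => ‖g z - g w‖ ^ 2) w ρ =
      Real.circleAverage (fun z => ‖dslope g w z‖ ^ 2) w ρ := by
  rw [← smul_eq_mul, ← Real.circleAverage_fun_smul]
  refine Real.circleAverage_congr_sphere fun z hz => ?_
  have hzw : ‖z - w‖ ^ 2 = ρ ^ 2 := by
    rw [mem_sphere, dist_eq_norm] at hz
    rw [hz, sq_abs]
  have hne : z ≠ w := by
    rintro rfl
    exact hρ (by simpa using hzw.symm)
  simp only [smul_eq_mul]
  rw [dslope_of_ne _ hne, slope_def_field, norm_div, div_pow, hzw]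
  field_simp

theorem continuous_dslope_of_differentiable {g : ℂ → ℂ} (hg : Differentiable ℂ g) (w : ℂ) :
    Continuous (dslope g w) := by
  rw [← continuousOn_univ, continuousOn_dslope Filter.univ_mem]
  exact ⟨hg.continuous.continuousOn, hg w⟩

theorem tendsto_inv_sq_mul_circleAverage {g : ℂ → ℂ} (hg : Differentiable ℂ g) (w : ℂ)
    {ρ : ℕ → ℝ} (hρ : ∀ n, ρ n ≠ 0) (hρ0 : Filter.Tendsto ρ Filter.atTop (nhds 0)) :
    Filter.Tendsto (fun n => (ρ n ^ 2)⁻¹ * Real.circleAverage (fun z => ‖g z - g w‖ ^ 2) w (ρ n))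
      Filter.atTop (nhds (‖deriv g w‖ ^ 2)) := by
  simp only [inv_sq_mul_circleAverage_eq w (hρ _)]
  have hc : Continuous fun z => ‖dslope g w z‖ ^ 2 :=
    (continuous_dslope_of_differentiable hg w).norm.pow 2
  have := ((Real.Continuous.circleAverage (c := w) hc).tendsto 0).comp hρ0
  simpa [Function.comp_def] using this

/-- Supplies the dominating constant for `ρ → 0`. Circles of radius at most `1` centred in the
closed unit disk lie in the closed disk of radius `2`, where the mean value inequality applies. -/
theorem exists_bound_inv_sq_mul_circleAverage {g : ℂ → ℂ} (hg : Differentiable ℂ g) :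
    ∃ L : ℝ, ∀ w ρ, ‖w‖ ≤ 1 → 0 < ρ → ρ ≤ 1 →
      |(ρ ^ 2)⁻¹ * Real.circleAverage (fun z => ‖g z - g w‖ ^ 2) w ρ| ≤ L := by
  obtain ⟨M, hM⟩ := (isCompact_closedBall (0 : ℂ) 2).exists_bound_of_continuousOn
    (hg.contDiff.continuous_deriv le_rfl).continuousOn
  refine ⟨M ^ 2, fun w ρ hw hρ hρ1 => ?_⟩
  rw [inv_sq_mul_circleAverage_eq w hρ.ne']
  have hc := (continuous_dslope_of_differentiable hg w).norm.pow 2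
  rw [abs_of_nonneg (Real.circleAverage_nonneg_of_nonneg fun x _ => by positivity)]
  refine Real.circleAverage_mono_on_of_le_circle (circleIntegrable_of_continuous hc _ _)
    fun z hz => ?_
  rw [abs_of_pos hρ, mem_sphere, dist_eq_norm] at hz
  have hne : z ≠ w := by rintro rfl; simp at hz; exact hρ.ne hz
  have hz2 : ‖z‖ ≤ 2 := by
    have := norm_add_le (z - w) w
    rw [sub_add_cancel] at this
    linarith
  have hmv := (convex_closedBall (0 : ℂ) 2).norm_image_sub_le_of_norm_deriv_le
    (fun x _ => hg x) hM (by simpa using hw.trans one_le_two) (by simpa using hz2 : z ∈ _)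
  rw [dslope_of_ne _ hne, slope_def_field, norm_div]
  refine pow_le_pow_left₀ (by positivity) ?_ 2
  rw [div_le_iff₀ (by rw [hz]; exact hρ)]
  exact hmv

/-! ### The inequality for polynomials and bounded weights. -/

section Polynomial

variable {W : ℂ → ℝ} {C r : ℝ}

/-- A function positive on the disk, with vanishing boundary values, whose Laplacian compares the
Dirichlet densities of a polynomial and of its dilation. -/
def comparisonPotential (r δ : ℝ) (a : ℕ → ℂ) (N : ℕ) (z : ℂ) : ℝ :=
  r * diskPotential a N z - diskPotential (dilatedCoeff r a) N z + δ * (1 - ‖z‖ ^ 2)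

theorem continuous_comparisonPotential (r δ : ℝ) (a : ℕ → ℂ) (N : ℕ) :
    Continuous (comparisonPotential r δ a N) := by
  have := continuous_diskPotential
  unfold comparisonPotential
  fun_prop

/-- The term `δ (1 - ‖z‖²)` makes the potential strictly positive, so its superlevel sets exhaust
the disk as `ε → 0`. -/
theorem comparisonPotential_pos (hr : 0 < r) (hr1 : r ≤ 1) {δ : ℝ} (hδ : 0 < δ) (a : ℕ → ℂ) (N : ℕ)
    {z : ℂ} (hz : ‖z‖ < 1) : 0 < comparisonPotential r δ a N z := by
  have h1 := diskPotential_dilatedCoeff_le hr hr1 a N hz.le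
  have h2 : ‖z‖ ^ 2 < 1 := pow_lt_one₀ (norm_nonneg _) hz two_ne_zero
  have h3 : 0 < δ * (1 - ‖z‖ ^ 2) := mul_pos hδ (by linarith)
  unfold comparisonPotential
  linarith

theorem comparisonPotential_eq_zero (r δ : ℝ) (a : ℕ → ℂ) (N : ℕ) {z : ℂ} (hz : ‖z‖ = 1) :
    comparisonPotential r δ a N z = 0 := by
  simp [comparisonPotential, diskPotential_eq, hz]

theorem comparisonPotential_sub_circleAverage (r δ : ℝ) (a : ℕ → ℂ) (N : ℕ) (w : ℂ) (ρ : ℝ) :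
    comparisonPotential r δ a N w - Real.circleAverage (comparisonPotential r δ a N) w ρ =
      r * Real.circleAverage (fun z => ‖tailSum a N 0 z - tailSum a N 0 w‖ ^ 2) w ρ -
      Real.circleAverage (fun z => ‖tailSum (dilatedCoeff r a) N 0 z -
        tailSum (dilatedCoeff r a) N 0 w‖ ^ 2) w ρ + δ * ρ ^ 2 := by
  have hc := continuous_diskPotential
  have e : comparisonPotential r δ a N = fun z => (r • diskPotential a N z -
      diskPotential (dilatedCoeff r a) N z) + δ • (1 - ‖z‖ ^ 2) := rfl
  rw [e, Real.circleAverage_fun_add (circleIntegrable_of_continuous (by fun_prop) _ _)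
      (circleIntegrable_of_continuous (by fun_prop) _ _),
    Real.circleAverage_fun_sub (circleIntegrable_of_continuous (by fun_prop) _ _)
      (circleIntegrable_of_continuous (by fun_prop) _ _),
    Real.circleAverage_fun_smul, Real.circleAverage_fun_smul,
    Real.circleAverage_fun_sub (circleIntegrable_of_continuous (by fun_prop) _ _)
      (circleIntegrable_of_continuous (by fun_prop) _ _), Real.circleAverage_const,
    circleAverage_norm_sq, circleAverage_diskPotential, circleAverage_diskPotential]
  simp only [smul_eq_mul]
  ring

theorem setIntegral_superlevel_nonneg (hr : 0 < r) (a : ℕ → ℂ) (N : ℕ)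
    (hW : Measurable W) (hW0 : ∀ z, 0 ≤ W z) (hC : ∀ z, ‖W z‖ ≤ C)
    (hmean : ∀ w ρ, 0 < ρ → closedBall w ρ ⊆ ball (0 : ℂ) 1 → Real.circleAverage W w ρ ≤ W w)
    (δ : ℝ) {ε : ℝ} (hε : 0 < ε) :
    0 ≤ ∫ z in superlevel (comparisonPotential r δ a N) ε,
      (r * ‖deriv (tailSum a N 0) z‖ ^ 2 -
        ‖deriv (tailSum (dilatedCoeff r a) N 0) z‖ ^ 2 + δ) * W z := by
  have hΦ := continuous_comparisonPotential r δ a N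
  obtain ⟨ρ₀, hρ₀, H⟩ := setIntegral_sub_circleAverage_nonneg hΦ
    (fun z hz => (comparisonPotential_eq_zero r δ a N hz).le) hW hW0 hC hmean hε
  have hda := differentiable_tailSum a N 0
  have hdb := differentiable_tailSum (dilatedCoeff r a) N 0
  obtain ⟨La, hLa⟩ := exists_bound_inv_sq_mul_circleAverage hda
  obtain ⟨Lb, hLb⟩ := exists_bound_inv_sq_mul_circleAverage hdb
  set m := min ρ₀ 1 with hm
  have hm0 : 0 < m := lt_min hρ₀ one_pos
  -- The exponent `n + 1` makes every radius, including the first, strictly less than `m`.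
  set ρ : ℕ → ℝ := fun n => m * (1 / 2) ^ (n + 1) with hρ
  have hρpos : ∀ n, 0 < ρ n := fun n => by positivity
  have hρlt : ∀ n, ρ n < m := fun n =>
    mul_lt_of_lt_one_right hm0 (pow_lt_one₀ (by norm_num) (by norm_num) n.succ_ne_zero)
  have hρ0 : Filter.Tendsto ρ Filter.atTop (nhds 0) := by
    have := ((tendsto_pow_atTop_nhds_zero_of_lt_one (r := (1 / 2 : ℝ)) (by norm_num)
      (by norm_num)).comp (Filter.tendsto_add_atTop_nat 1)).const_mul m
    simpa [hρ, Function.comp_def] using this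
  set A : ℕ → ℂ → ℝ := fun n w => (ρ n ^ 2)⁻¹ *
    Real.circleAverage (fun z => ‖tailSum a N 0 z - tailSum a N 0 w‖ ^ 2) w (ρ n) with hA
  set B : ℕ → ℂ → ℝ := fun n w => (ρ n ^ 2)⁻¹ * Real.circleAverage (fun z =>
    ‖tailSum (dilatedCoeff r a) N 0 z - tailSum (dilatedCoeff r a) N 0 w‖ ^ 2) w (ρ n) with hB
  have heq : ∀ n w, (ρ n ^ 2)⁻¹ * ((comparisonPotential r δ a N w -
      Real.circleAverage (comparisonPotential r δ a N) w (ρ n)) * W w) =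
      (r * A n w - B n w + δ) * W w := fun n w => by
    rw [comparisonPotential_sub_circleAverage, hA, hB]
    have := (hρpos n).ne'
    field_simp
  have hlim : Filter.Tendsto (fun n => ∫ z in superlevel (comparisonPotential r δ a N) ε,
      (ρ n ^ 2)⁻¹ * ((comparisonPotential r δ a N z -
        Real.circleAverage (comparisonPotential r δ a N) z (ρ n)) * W z)) Filter.atTop
      (nhds (∫ z in superlevel (comparisonPotential r δ a N) ε,
      (r * ‖deriv (tailSum a N 0) z‖ ^ 2 -
        ‖deriv (tailSum (dilatedCoeff r a) N 0) z‖ ^ 2 + δ) * W z)) := by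
    have hfin : volume (superlevel (comparisonPotential r δ a N) ε) ≠ ∞ :=
      ((measure_mono (superlevel_subset_ball _ _)).trans_lt measure_ball_lt_top).ne
    refine tendsto_integral_of_dominated_convergence (fun _ => (r * La + Lb + |δ|) * C)
      (fun n => ?_) (integrableOn_const hfin) (fun n => ?_) ?_
    · exact ((hΦ.sub (continuous_circleAverage_center hΦ _)).measurable.mul
        hW).const_mul _ |>.aestronglyMeasurable
    · refine (ae_restrict_mem (measurableSet_superlevel hΦ ε)).mono fun w hw => ?_
      rw [heq, norm_mul]
      have h1 := abs_le.1 (hLa w (ρ n) hw.1.le (hρpos n) ((hρlt n).le.trans (min_le_right _ _)))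
      have h2 := abs_le.1 (hLb w (ρ n) hw.1.le (hρpos n) ((hρlt n).le.trans (min_le_right _ _)))
      have h3 : ‖r * A n w - B n w + δ‖ ≤ r * La + Lb + |δ| := by
        rw [Real.norm_eq_abs, abs_le]
        have h4 := mul_le_mul_of_nonneg_left h1.1 hr.le
        have h5 := mul_le_mul_of_nonneg_left h1.2 hr.le
        constructor <;> linarith [h2.1, h2.2, le_abs_self δ, neg_abs_le δ]
      exact mul_le_mul h3 (hC w) (norm_nonneg _) ((norm_nonneg _).trans h3)
    · refine Filter.Eventually.of_forall fun w => ?_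
      simp only [heq]
      exact ((((tendsto_inv_sq_mul_circleAverage hda w (fun n => (hρpos n).ne') hρ0).const_mul
        r).sub (tendsto_inv_sq_mul_circleAverage hdb w (fun n => (hρpos n).ne') hρ0)).add_const
        δ).mul_const _
  refine ge_of_tendsto' hlim fun n => ?_
  rw [integral_const_mul]
  exact mul_nonneg (by positivity) (H (ρ n) (hρpos n) ((hρlt n).trans_le (min_le_left _ _)))

/-- Two limits in this order: `ε → 0` with `δ` fixed, by exhaustion of the disk, then `δ → 0`. -/
theorem setIntegral_deriv_dilated_tailSum_le (hr : 0 < r) (hr1 : r ≤ 1) (a : ℕ → ℂ) (N : ℕ)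
    (hW : Measurable W) (hW0 : ∀ z, 0 ≤ W z) (hC : ∀ z, ‖W z‖ ≤ C)
    (hmean : ∀ w ρ, 0 < ρ → closedBall w ρ ⊆ ball (0 : ℂ) 1 → Real.circleAverage W w ρ ≤ W w) :
    ∫ z in ball (0 : ℂ) 1, ‖(r : ℂ) * deriv (tailSum a N 0) (r * z)‖ ^ 2 * W z ≤
      r * ∫ z in ball (0 : ℂ) 1, ‖deriv (tailSum a N 0) z‖ ^ 2 * W z := by
  have hderiv : ∀ z, deriv (tailSum (dilatedCoeff r a) N 0) z =
      (r : ℂ) * deriv (tailSum a N 0) (r * z) := fun z => by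
    rw [show tailSum (dilatedCoeff r a) N 0 = fun z => tailSum a N 0 (r * z) from
      funext fun z => tailSum_dilatedCoeff_zero r a N z, deriv_comp_mul_left, smul_eq_mul]
  have hca := ((differentiable_tailSum a N 0).contDiff (n := 1)).continuous_deriv le_rfl
  have hcb := ((differentiable_tailSum (dilatedCoeff r a) N 0).contDiff
    (n := 1)).continuous_deriv le_rfl
  have hlevel : ∀ δ, 0 < δ → 0 ≤ ∫ z in ball (0 : ℂ) 1,
      (r * ‖deriv (tailSum a N 0) z‖ ^ 2 -
        ‖deriv (tailSum (dilatedCoeff r a) N 0) z‖ ^ 2 + δ) * W z := fun δ hδ => by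
    have hU : ball (0 : ℂ) 1 =
        ⋃ n : ℕ, superlevel (comparisonPotential r δ a N) (1 / ((n : ℝ) + 1)) := by
      refine Subset.antisymm (fun z hz => ?_)
        (iUnion_subset fun n => superlevel_subset_ball _ _)
      have hz' : ‖z‖ < 1 := by simpa using hz
      obtain ⟨n, hn⟩ := exists_nat_one_div_lt (comparisonPotential_pos hr hr1 hδ a N hz')
      exact mem_iUnion.2 ⟨n, hz', hn⟩
    have hmono : Monotone fun n : ℕ =>
        superlevel (comparisonPotential r δ a N) (1 / ((n : ℝ) + 1)) := fun m n hmn z hz =>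
      ⟨hz.1, (Nat.one_div_le_one_div hmn).trans_lt hz.2⟩
    have hlim := tendsto_setIntegral_of_monotone (μ := volume)
      (f := fun z => (r * ‖deriv (tailSum a N 0) z‖ ^ 2 -
        ‖deriv (tailSum (dilatedCoeff r a) N 0) z‖ ^ 2 + δ) * W z)
      (fun n => measurableSet_superlevel (continuous_comparisonPotential r δ a N) _) hmono
      (by rw [← hU]; exact integrableOn_continuous_mul (by fun_prop) hW hC subset_rfl)
    rw [← hU] at hlim
    exact ge_of_tendsto' hlim fun n =>
      setIntegral_superlevel_nonneg hr a N hW hW0 hC hmean δ (by positivity)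
  have hiA := integrableOn_continuous_mul (Φ := fun z => ‖deriv (tailSum a N 0) z‖ ^ 2)
    (by fun_prop) hW hC (subset_refl (ball (0 : ℂ) 1))
  have hiB := integrableOn_continuous_mul
    (Φ := fun z => ‖deriv (tailSum (dilatedCoeff r a) N 0) z‖ ^ 2)
    (by fun_prop) hW hC (subset_refl (ball (0 : ℂ) 1))
  have hiW := integrableOn_continuous_mul (Φ := fun _ => 1)
    (by fun_prop) hW hC (subset_refl (ball (0 : ℂ) 1))
  simp only [← hderiv]
  have hexp : ∀ δ, ∫ z in ball (0 : ℂ) 1, (r * ‖deriv (tailSum a N 0) z‖ ^ 2 -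
        ‖deriv (tailSum (dilatedCoeff r a) N 0) z‖ ^ 2 + δ) * W z =
      r * (∫ z in ball (0 : ℂ) 1, ‖deriv (tailSum a N 0) z‖ ^ 2 * W z) -
      (∫ z in ball (0 : ℂ) 1, ‖deriv (tailSum (dilatedCoeff r a) N 0) z‖ ^ 2 * W z) +
      δ * ∫ z in ball (0 : ℂ) 1, 1 * W z := fun δ => by
    rw [← integral_const_mul, ← integral_const_mul, ← integral_sub (hiA.const_mul r) hiB,
      ← integral_add (by exact (hiA.const_mul r).sub hiB) (hiW.const_mul δ)]
    refine integral_congr_ae (Filter.Eventually.of_forall fun z => ?_)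
    simp only
    ring
  have hW1 : 0 ≤ ∫ z in ball (0 : ℂ) 1, 1 * W z :=
    integral_nonneg fun z => by simpa using hW0 z
  refine le_of_forall_pos_le_add fun η hη => ?_
  -- This `δ` makes the error `δ ∫ W` at most `η`; the `+ 1` keeps the denominator positive when `∫
  -- W = 0`.
  have h := hlevel (η / ((∫ z in ball (0 : ℂ) 1, 1 * W z) + 1)) (by positivity)
  rw [hexp] at h
  have : η / ((∫ z in ball (0 : ℂ) 1, 1 * W z) + 1) * (∫ z in ball (0 : ℂ) 1, 1 * W z) ≤ η := by
    rw [div_mul_eq_mul_div, div_le_iff₀ (by positivity)]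
    nlinarith
  linarith

end Polynomial

/-! ### Passage to functions holomorphic on a larger disk. -/

section Holomorphic

variable {W : ℂ → ℝ} {C r : ℝ}

theorem exists_tailSum_tendstoLocallyUniformlyOn {F : ℂ → ℂ} {R : ℝ} (hR : 0 < R)
    (hF : DifferentiableOn ℂ F (closedBall 0 R)) : ∃ a : ℕ → ℂ,
      TendstoLocallyUniformlyOn (fun n => tailSum a n 0) F Filter.atTop (ball 0 R) := by
  lift R to NNReal using hR.le
  have h := (hF.hasFPowerSeriesOnBall hR).tendstoLocallyUniformlyOn
  refine ⟨(cauchyPowerSeries F 0 R).coeff, ?_⟩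
  rw [Metric.eball_coe] at h
  simp only [zero_add] at h
  convert h using 3 with n z
  rw [tailSum_zero, FormalMultilinearSeries.partialSum]
  refine Finset.sum_congr rfl fun k _ => ?_
  rw [FormalMultilinearSeries.apply_eq_pow_smul_coeff, smul_eq_mul, mul_comm]

theorem tendsto_setIntegral_norm_sq_mul {g : ℕ → ℂ → ℂ} {G : ℂ → ℂ} {M : ℝ}
    (hW : Measurable W) (hC : ∀ z, ‖W z‖ ≤ C)
    (hg : ∀ n, Continuous (g n))
    (hM : ∀ᶠ n in Filter.atTop, ∀ z ∈ ball (0 : ℂ) 1, ‖g n z‖ ≤ M)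
    (hlim : ∀ z ∈ ball (0 : ℂ) 1, Filter.Tendsto (fun n => g n z) Filter.atTop (nhds (G z))) :
    Filter.Tendsto (fun n => ∫ z in ball (0 : ℂ) 1, ‖g n z‖ ^ 2 * W z) Filter.atTop
      (nhds (∫ z in ball (0 : ℂ) 1, ‖G z‖ ^ 2 * W z)) := by
  refine tendsto_integral_filter_of_dominated_convergence (fun _ => M ^ 2 * C)
    (Filter.Eventually.of_forall fun n =>
      (((hg n).norm.pow 2).measurable.mul hW).aestronglyMeasurable) ?_
    (integrableOn_const measure_ball_lt_top.ne) ?_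
  · filter_upwards [hM] with n hn
    refine (ae_restrict_mem measurableSet_ball).mono fun z hz => ?_
    rw [norm_mul, norm_pow, norm_norm]
    exact mul_le_mul (pow_le_pow_left₀ (norm_nonneg _) (hn z hz) 2) (hC z) (norm_nonneg _)
      (sq_nonneg M)
  · refine (ae_restrict_mem measurableSet_ball).mono fun z hz => ?_
    exact ((hlim z hz).norm.pow 2).mul_const _

theorem setIntegral_deriv_dilation_le (hr : 0 < r) (hr1 : r ≤ 1) {F : ℂ → ℂ} {R : ℝ} (hR : 1 < R)
    (hF : DifferentiableOn ℂ F (closedBall 0 R))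
    (hW : Measurable W) (hW0 : ∀ z, 0 ≤ W z) (hC : ∀ z, ‖W z‖ ≤ C)
    (hmean : ∀ w ρ, 0 < ρ → closedBall w ρ ⊆ ball (0 : ℂ) 1 → Real.circleAverage W w ρ ≤ W w) :
    ∫ z in ball (0 : ℂ) 1, ‖(r : ℂ) * deriv F (r * z)‖ ^ 2 * W z ≤
      r * ∫ z in ball (0 : ℂ) 1, ‖deriv F z‖ ^ 2 * W z := by
  obtain ⟨a, ha⟩ := exists_tailSum_tendstoLocallyUniformlyOn (one_pos.trans hR) hF
  have hd := ha.deriv (Filter.Eventually.of_forall fun n =>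
    (differentiable_tailSum a n 0).differentiableOn) isOpen_ball
  have hsub : closedBall (0 : ℂ) 1 ⊆ ball 0 R := closedBall_subset_ball hR
  have hun := (tendstoLocallyUniformlyOn_iff_forall_isCompact isOpen_ball).1 hd _ hsub
    (isCompact_closedBall 0 1)
  have hcont : ∀ n, Continuous (deriv (tailSum a n 0)) := fun n =>
    ((differentiable_tailSum a n 0).contDiff (n := 1)).continuous_deriv le_rfl
  obtain ⟨M, hM⟩ := (isCompact_closedBall (0 : ℂ) 1).exists_bound_of_continuousOn
    (((hF.mono ball_subset_closedBall).deriv isOpen_ball).continuousOn.mono hsub)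
  have hbound : ∀ᶠ n in Filter.atTop, ∀ z ∈ closedBall (0 : ℂ) 1,
      ‖deriv (tailSum a n 0) z‖ ≤ M + 1 := by
    filter_upwards [Metric.tendstoUniformlyOn_iff.1 hun 1 one_pos] with n hn z hz
    have h1 := hn z hz
    rw [dist_comm, dist_eq_norm] at h1
    have h2 := norm_le_norm_add_norm_sub' (deriv (tailSum a n 0) z) (deriv F z)
    simp only [Function.comp] at h1
    linarith [hM z hz]
  have hmem : ∀ z ∈ ball (0 : ℂ) 1, (r : ℂ) * z ∈ closedBall (0 : ℂ) 1 := fun z hz => by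
    simp only [mem_ball, dist_zero_right, mem_closedBall, norm_mul, Complex.norm_real,
      Real.norm_eq_abs, abs_of_pos hr] at hz ⊢
    exact mul_le_one₀ hr1 (norm_nonneg _) hz.le
  have hpt : ∀ z ∈ closedBall (0 : ℂ) 1, Filter.Tendsto (fun n => deriv (tailSum a n 0) z)
      Filter.atTop (nhds (deriv F z)) := fun z hz => hun.tendsto_at hz
  have l1 := tendsto_setIntegral_norm_sq_mul hW hC hcont
    (hbound.mono fun n hn z hz => hn z (ball_subset_closedBall hz))
    fun z hz => hpt z (ball_subset_closedBall hz)
  have l2 := tendsto_setIntegral_norm_sq_mul (M := r * (M + 1)) hW hC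
    (g := fun n z => (r : ℂ) * deriv (tailSum a n 0) (r * z))
    (fun n => by have := hcont n; fun_prop)
    (hbound.mono fun n hn z hz => by
      rw [norm_mul, Complex.norm_real, Real.norm_eq_abs, abs_of_pos hr]
      exact mul_le_mul_of_nonneg_left (hn _ (hmem z hz)) hr.le)
    fun z hz => (hpt _ (hmem z hz)).const_mul (r : ℂ)
  exact le_of_tendsto_of_tendsto' l2 (l1.const_mul r) fun n =>
    setIntegral_deriv_dilated_tailSum_le hr hr1 a n hW hW0 hC hmean

end Holomorphic

/-! ### Reduction of smaller disks to the unit disk. -/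

section Scaling

variable {W : ℂ → ℝ} {C r R : ℝ}

theorem setIntegral_ball_deriv_dilation_le (hr : 0 < r) (hr1 : r ≤ 1) (hR : 0 < R) (hR1 : R < 1)
    {f : ℂ → ℂ} (hf : DifferentiableOn ℂ f (ball 0 1))
    (hW : Measurable W) (hW0 : ∀ z, 0 ≤ W z) (hC : ∀ z, ‖W z‖ ≤ C)
    (hmean : ∀ w ρ, 0 < ρ → closedBall w ρ ⊆ ball (0 : ℂ) 1 → Real.circleAverage W w ρ ≤ W w) :
    ∫ z in ball (0 : ℂ) R, ‖(r : ℂ) * deriv f (r * z)‖ ^ 2 * W z ≤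
      r * ∫ z in ball (0 : ℂ) R, ‖deriv f z‖ ^ 2 * W z := by
  have hRR : R * ((1 + R⁻¹) / 2) < 1 := by
    have : R * ((1 + R⁻¹) / 2) = (R + 1) / 2 := by field_simp
    linarith
  have hRinv : 1 < R⁻¹ := (one_lt_inv₀ hR).2 hR1
  -- The radius is the midpoint of `1` and `R⁻¹`: it exceeds `1`, and its multiple by `R` is still
  -- below `1`.
  have hF : DifferentiableOn ℂ (fun z => f ((R : ℂ) * z)) (closedBall 0 ((1 + R⁻¹) / 2)) := by
    refine hf.comp (by fun_prop) fun z hz => ?_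
    simp only [mem_closedBall, dist_zero_right, mem_ball, norm_mul, Complex.norm_real,
      Real.norm_eq_abs, abs_of_pos hR] at hz ⊢
    exact (mul_le_mul_of_nonneg_left hz hR.le).trans_lt hRR
  have hmean' : ∀ w ρ, 0 < ρ → closedBall w ρ ⊆ ball (0 : ℂ) 1 →
      Real.circleAverage (fun z => W (R * z)) w ρ ≤ W (R * w) := fun w ρ hρ hb => by
    refine le_of_eq_of_le ?_ (hmean (R * w) (R * ρ) (mul_pos hR hρ) fun z hz => ?_)
    · simp only [Real.circleAverage_def, circleMap]
      congr 2
      funext θ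
      congr 1
      push_cast
      ring
    · have hz' : (R : ℂ)⁻¹ * z ∈ ball (0 : ℂ) 1 := hb <| by
        rw [mem_closedBall, dist_eq_norm] at hz ⊢
        have : (R : ℂ)⁻¹ * z - w = (R : ℂ)⁻¹ * (z - R * w) := by
          have : (R : ℂ) ≠ 0 := by exact_mod_cast hR.ne'
          field_simp
        rw [this, norm_mul, norm_inv, Complex.norm_real, Real.norm_eq_abs, abs_of_pos hR,
          inv_mul_le_iff₀ hR]
        exact hz
      simp only [mem_ball, dist_zero_right, norm_mul, norm_inv, Complex.norm_real,
        Real.norm_eq_abs, abs_of_pos hR] at hz' ⊢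
      rw [inv_mul_lt_iff₀ hR] at hz'
      linarith
  have key := setIntegral_deriv_dilation_le hr hr1 (by linarith) hF
    (W := fun z => W (R * z)) (hW.comp (measurable_const_mul _)) (fun z => hW0 _)
    (fun z => hC _) hmean'
  have hderiv : ∀ z, deriv (fun z => f ((R : ℂ) * z)) z = R * deriv f (R * z) := fun z => by
    rw [deriv_comp_mul_left, smul_eq_mul]
  simp only [hderiv] at key
  -- The Jacobian `R⁻²` cancels the factor `R²` produced by the chain rule on both sides.
  have hscale : ∀ G : ℂ → ℝ, ∫ z in ball (0 : ℂ) 1, G (R * z) =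
      |(R ^ 2)⁻¹| * ∫ z in ball (0 : ℂ) R, G z := fun G => by
    have := Measure.setIntegral_comp_smul (volume : Measure ℂ) G (ball (0 : ℂ) 1) hR.ne'
    rw [smul_unitBall hR.ne', Complex.finrank_real_complex, Real.norm_eq_abs,
      abs_of_pos hR] at this
    simpa only [Complex.real_smul, smul_eq_mul] using this
  have e1 : ∀ z : ℂ, ‖(r : ℂ) * (R * deriv f (R * (r * z)))‖ ^ 2 * W (R * z) =
      (fun w => R ^ 2 * (‖(r : ℂ) * deriv f (r * w)‖ ^ 2 * W w)) (R * z) := fun z => by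
    simp only [norm_mul, Complex.norm_real, Real.norm_eq_abs, mul_pow, sq_abs]
    rw [mul_left_comm (R : ℂ)]
    ring
  have e2 : ∀ z : ℂ, ‖(R : ℂ) * deriv f (R * z)‖ ^ 2 * W (R * z) =
      (fun w => R ^ 2 * (‖deriv f w‖ ^ 2 * W w)) (R * z) := fun z => by
    simp only [norm_mul, Complex.norm_real, Real.norm_eq_abs, mul_pow, sq_abs]
    ring
  simp only [e1, e2] at key
  rw [hscale fun w => R ^ 2 * (‖(r : ℂ) * deriv f (r * w)‖ ^ 2 * W w),
    hscale fun w => R ^ 2 * (‖deriv f w‖ ^ 2 * W w), integral_const_mul, integral_const_mul,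
    abs_of_nonneg (by positivity), inv_mul_cancel_left₀ (by positivity),
    inv_mul_cancel_left₀ (by positivity)] at key
  exact key

end Scaling

/-! ### Extended-valued weights with the super-mean-value property. -/

section Weights

variable {ω : ℂ → ℝ≥0∞} {r : ℝ} {f : ℂ → ℂ}

/-- The super-mean-value inequality on circles bounding closed disks inside the unit disk. -/
def HasSuperMean (ω : ℂ → ℝ≥0∞) : Prop :=
  ∀ (w : ℂ) (ρ : ℝ), 0 < ρ → closedBall w ρ ⊆ ball (0 : ℂ) 1 →
    ENNReal.ofReal (1 / (2 * Real.pi)) *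
      (∫⁻ θ in Ioc (0 : ℝ) (2 * Real.pi), ω (circleMap w ρ θ)) ≤ ω w

theorem ofReal_inv_two_pi_mul_const (c : ℝ≥0∞) :
    ENNReal.ofReal (1 / (2 * Real.pi)) * ∫⁻ _ in Ioc (0 : ℝ) (2 * Real.pi), c = c := by
  rw [setLIntegral_const, Real.volume_Ioc, sub_zero, mul_left_comm,
    ← ENNReal.ofReal_mul (by positivity), one_div, inv_mul_cancel₀ (by positivity)]
  simp

theorem HasSuperMean.min_const (h : HasSuperMean ω) (c : ℝ≥0∞) :
    HasSuperMean fun z => min (ω z) c := fun w ρ hρ hb =>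
  le_min
    ((mul_le_mul_right (lintegral_mono fun _ => min_le_left _ _) _).trans (h w ρ hρ hb))
    ((mul_le_mul_right (lintegral_mono fun _ => min_le_right _ _) _).trans
      (ofReal_inv_two_pi_mul_const c).le)

theorem HasSuperMean.circleAverage_toReal_le (h : HasSuperMean ω) (hm : Measurable ω)
    (hfin : ∀ z, ω z ≠ ∞) {w : ℂ} {ρ : ℝ} (hρ : 0 < ρ) (hb : closedBall w ρ ⊆ ball (0 : ℂ) 1) :
    Real.circleAverage (fun z => (ω z).toReal) w ρ ≤ (ω w).toReal := by
  rw [circleAverage_eq_setIntegral, integral_toReal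
    (f := fun θ => ω (circleMap w ρ θ))
    (hm.comp (continuous_circleMap w ρ).measurable).aemeasurable
    (Filter.Eventually.of_forall fun _ => (hfin _).lt_top)]
  have := ENNReal.toReal_mono (hfin w) (h w ρ hρ hb)
  rwa [ENNReal.toReal_mul, ENNReal.toReal_ofReal (by positivity), one_div] at this

theorem ofReal_setIntegral_norm_sq_mul {g : ℂ → ℂ} {R : ℝ} {c : ℝ}
    (hg : ContinuousOn g (closedBall 0 R)) (hm : Measurable ω)
    (hc : ∀ z, ω z ≤ ENNReal.ofReal c) :
    ENNReal.ofReal (∫ z in ball (0 : ℂ) R, ‖g z‖ ^ 2 * (ω z).toReal) =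
      ∫⁻ z in ball (0 : ℂ) R, ‖g z‖ₑ ^ 2 * ω z := by
  have hfin : ∀ z, ω z ≠ ∞ := fun z => ((hc z).trans_lt ENNReal.ofReal_lt_top).ne
  rw [ofReal_integral_eq_lintegral_ofReal _ (Filter.Eventually.of_forall fun z => by positivity)]
  · refine lintegral_congr fun z => ?_
    rw [ENNReal.ofReal_mul (by positivity), ENNReal.ofReal_toReal (hfin z),
      ENNReal.ofReal_pow (norm_nonneg _), ofReal_norm]
  · refine IntegrableOn.mono_set ?_ ball_subset_closedBall
    refine ((hg.norm.pow 2).integrableOn_compact (isCompact_closedBall (0 : ℂ) R)).mul_bdd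
      (c := (ENNReal.ofReal c).toReal) hm.ennreal_toReal.aestronglyMeasurable
      (Filter.Eventually.of_forall fun z => ?_)
    rw [Real.norm_eq_abs, abs_of_nonneg ENNReal.toReal_nonneg]
    exact ENNReal.toReal_mono ENNReal.ofReal_ne_top (hc z)

theorem setLIntegral_ball_deriv_dilation_le (hr : 0 < r) (hr1 : r ≤ 1)
    (hf : DifferentiableOn ℂ f (ball 0 1)) (hm : Measurable ω) (h : HasSuperMean ω) {c : ℝ}
    (hc : ∀ z, ω z ≤ ENNReal.ofReal c) {R : ℝ} (hR : 0 < R) (hR1 : R < 1) :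
    ∫⁻ z in ball (0 : ℂ) R, ‖(r : ℂ) * deriv f (r * z)‖ₑ ^ 2 * ω z ≤
      ENNReal.ofReal r * ∫⁻ z in ball (0 : ℂ) R, ‖deriv f z‖ₑ ^ 2 * ω z := by
  have hfin : ∀ z, ω z ≠ ∞ := fun z => ((hc z).trans_lt ENNReal.ofReal_lt_top).ne
  have hsub : closedBall (0 : ℂ) R ⊆ ball 0 1 := closedBall_subset_ball hR1
  have hcont : ContinuousOn (deriv f) (closedBall 0 R) :=
    (hf.deriv isOpen_ball).continuousOn.mono hsub
  have hcont' : ContinuousOn (fun z => (r : ℂ) * deriv f (r * z)) (closedBall 0 R) := by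
    refine continuousOn_const.mul (hcont.comp (by fun_prop) fun z hz => ?_)
    simp only [mem_closedBall, dist_zero_right, norm_mul, Complex.norm_real,
      Real.norm_eq_abs, abs_of_pos hr] at hz ⊢
    exact (mul_le_of_le_one_left (norm_nonneg _) hr1).trans hz
  rw [← ofReal_setIntegral_norm_sq_mul hcont hm hc, ← ofReal_setIntegral_norm_sq_mul hcont' hm hc,
    ← ENNReal.ofReal_mul hr.le]
  refine ENNReal.ofReal_le_ofReal (setIntegral_ball_deriv_dilation_le hr hr1 hR hR1 hf
    hm.ennreal_toReal (fun z => ENNReal.toReal_nonneg) (C := (ENNReal.ofReal c).toReal)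
    (fun z => ?_) fun w ρ hρ hb => h.circleAverage_toReal_le hm hfin hρ hb)
  rw [Real.norm_eq_abs, abs_of_nonneg ENNReal.toReal_nonneg]
  exact ENNReal.toReal_mono ENNReal.ofReal_ne_top (hc z)

theorem setLIntegral_deriv_dilation_le_of_bounded (hr : 0 < r) (hr1 : r ≤ 1)
    (hf : DifferentiableOn ℂ f (ball 0 1)) (hm : Measurable ω) (h : HasSuperMean ω) {c : ℝ}
    (hc : ∀ z, ω z ≤ ENNReal.ofReal c) :
    ∫⁻ z in ball (0 : ℂ) 1, ‖(r : ℂ) * deriv f (r * z)‖ₑ ^ 2 * ω z ≤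
      ENNReal.ofReal r * ∫⁻ z in ball (0 : ℂ) 1, ‖deriv f z‖ₑ ^ 2 * ω z := by
  -- The shift by `2` keeps the radius positive already at `n = 0`.
  have hU : ball (0 : ℂ) 1 = ⋃ n : ℕ, ball (0 : ℂ) (1 - 1 / ((n : ℝ) + 2)) := by
    refine Subset.antisymm (fun z hz => ?_) (iUnion_subset fun n => ball_subset_ball ?_)
    · have hz' : 0 < 1 - ‖z‖ := by simpa using hz
      obtain ⟨n, hn⟩ := exists_nat_one_div_lt hz'
      refine mem_iUnion.2 ⟨n, ?_⟩
      have : 1 / ((n : ℝ) + 2) ≤ 1 / ((n : ℝ) + 1) :=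
        one_div_le_one_div_of_le (by positivity) (by linarith)
      simp only [mem_ball, dist_zero_right]
      linarith
    · have : 0 < 1 / ((n : ℝ) + 2) := by positivity
      linarith
  have hmono : Monotone fun n : ℕ => ball (0 : ℂ) (1 - 1 / ((n : ℝ) + 2)) := fun m n hmn => by
    refine ball_subset_ball ?_
    have : 1 / ((n : ℝ) + 2) ≤ 1 / ((m : ℝ) + 2) :=
      one_div_le_one_div_of_le (by positivity) (by simpa using hmn)
    linarith
  conv_lhs => rw [hU, setLIntegral_iUnion_of_directed _ (directed_of_isDirected_le hmono)]
  refine iSup_le fun n => ?_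
  have h1 : 1 / ((n : ℝ) + 2) < 1 := by
    rw [div_lt_one (by positivity)]
    have : (0 : ℝ) ≤ n := n.cast_nonneg
    linarith
  have h2 : 0 < 1 / ((n : ℝ) + 2) := by positivity
  refine (setLIntegral_ball_deriv_dilation_le hr hr1 hf hm h hc (by linarith)
    (by linarith)).trans (mul_le_mul_right (lintegral_mono_set ?_) _)
  exact ball_subset_ball (by linarith)

/-- Truncations `min ω n` keep the super-mean-value property and increase to `ω`, so monotone
convergence removes the bound. -/
theorem setLIntegral_deriv_dilation_le (hr : 0 < r) (hr1 : r ≤ 1)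
    (hf : DifferentiableOn ℂ f (ball 0 1)) (hm : Measurable ω) (h : HasSuperMean ω) :
    ∫⁻ z in ball (0 : ℂ) 1, ‖(r : ℂ) * deriv f (r * z)‖ₑ ^ 2 * ω z ≤
      ENNReal.ofReal r * ∫⁻ z in ball (0 : ℂ) 1, ‖deriv f z‖ₑ ^ 2 * ω z := by
  have hsup : ∀ x : ℝ≥0∞, ⨆ n : ℕ, min x n = x := fun x => by
    rw [← inf_iSup_eq, ENNReal.iSup_natCast, inf_top_eq]
  have hdm : Measurable fun z => ‖(r : ℂ) * deriv f (r * z)‖ₑ ^ 2 :=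
    ((((measurable_deriv f).comp (measurable_const_mul (r : ℂ))).const_mul (r : ℂ)).enorm).pow_const 2
  have hlhs : ∀ z, ‖(r : ℂ) * deriv f (r * z)‖ₑ ^ 2 * ω z =
      ⨆ n : ℕ, ‖(r : ℂ) * deriv f (r * z)‖ₑ ^ 2 * min (ω z) n := fun z => by
    rw [← ENNReal.mul_iSup, hsup]
  simp only [hlhs]
  rw [lintegral_iSup (f := fun (n : ℕ) z => ‖(r : ℂ) * deriv f (r * z)‖ₑ ^ 2 * min (ω z) n)
    (fun n => hdm.mul (hm.min measurable_const)) fun m n hmn z =>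
    mul_le_mul_right (min_le_min_left _ (by exact_mod_cast hmn)) _]
  refine iSup_le fun n => ?_
  refine (setLIntegral_deriv_dilation_le_of_bounded hr hr1 hf (hm.min measurable_const)
    (h.min_const n) (c := n) fun z => ?_).trans
    (mul_le_mul_right (lintegral_mono fun z => mul_le_mul_right (min_le_left _ _) _) _)
  rw [ENNReal.ofReal_natCast]
  exact min_le_right _ _

theorem dirichletIntegral_eq (ω : ℂ → ℝ≥0∞) (f : ℂ → ℂ) :
    dirichletIntegral ω f = ENNReal.ofReal (1 / Real.pi) *
      ∫⁻ z in ball (0 : ℂ) 1, ‖deriv f z‖ₑ ^ 2 * ω z := by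
  rw [dirichletIntegral, diskArea, lintegral_smul_measure, smul_eq_mul]

/-- Dilation contracts the Dirichlet integral by the factor `r`, for every measurable weight with
the super-mean-value property. -/
theorem dirichletIntegral_dilation_le (hr : 0 ≤ r) (hr1 : r ≤ 1)
    (hf : DifferentiableOn ℂ f (ball 0 1)) (hm : Measurable ω) (h : HasSuperMean ω) :
    dirichletIntegral ω (dilation r f) ≤ ENNReal.ofReal r * dirichletIntegral ω f := by
  have hderiv : ∀ z, deriv (dilation r f) z = r * deriv f (r * z) := fun z => by
    unfold dilation
    rw [deriv_comp_mul_left, smul_eq_mul]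
  simp only [dirichletIntegral_eq, hderiv]
  rcases hr.eq_or_lt with rfl | hr
  · simp
  · rw [mul_left_comm]
    exact mul_le_mul_right (setLIntegral_deriv_dilation_le hr hr1 hf hm h) _

theorem le_two_mul_div_one_add (hr : 0 ≤ r) (hr1 : r ≤ 1) : r ≤ 2 * r / (1 + r) := by
  rw [le_div_iff₀ (by linarith)]
  nlinarith

/-- A superharmonic weight is unconstrained off the disk; cutting it to zero there gives global
measurability without changing the Dirichlet integral. -/
theorem IsSuperharmonicWeight.measurable_indicator (h : IsSuperharmonicWeight ω) :
    Measurable ((ball (0 : ℂ) 1).indicator ω) := by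
  refine measurable_of_Ioi fun a => ?_
  obtain ⟨u, hu, hua⟩ := lowerSemicontinuousOn_iff_preimage_Ioi.1 h.lowerSemicontinuousOn a
  have : (ball (0 : ℂ) 1).indicator ω ⁻¹' Ioi a = ball (0 : ℂ) 1 ∩ ω ⁻¹' Ioi a := by
    ext z
    by_cases hz : z ∈ ball (0 : ℂ) 1 <;> simp [indicator, hz]
  rw [this, hua]
  exact measurableSet_ball.inter hu.measurableSet

theorem IsSuperharmonicWeight.hasSuperMean_indicator (h : IsSuperharmonicWeight ω) :
    HasSuperMean ((ball (0 : ℂ) 1).indicator ω) := fun w ρ hρ hb => by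
  rw [indicator_of_mem (hb (mem_closedBall_self hρ.le))]
  refine le_of_eq_of_le ?_ (h.circle_mean_le w ρ hρ hb)
  congr 1
  refine lintegral_congr fun θ => ?_
  rw [indicator_of_mem (hb (circleMap_mem_closedBall w hρ.le θ))]

theorem dirichletIntegral_indicator (ω : ℂ → ℝ≥0∞) (f : ℂ → ℂ) :
    dirichletIntegral ((ball (0 : ℂ) 1).indicator ω) f = dirichletIntegral ω f := by
  rw [dirichletIntegral_eq, dirichletIntegral_eq]
  congr 1
  refine setLIntegral_congr_fun measurableSet_ball fun z hz => ?_
  simp only [indicator_of_mem hz]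

end Weights

/-! ### Super-mean-value property of the Poisson and Green kernels. -/

theorem ofReal_circleAverage {g : ℂ → ℝ} {w : ℂ} {ρ : ℝ} (hg : CircleIntegrable g w ρ)
    (h0 : ∀ᵐ θ : ℝ, 0 ≤ g (circleMap w ρ θ)) :
    ENNReal.ofReal (Real.circleAverage g w ρ) = ENNReal.ofReal (1 / (2 * Real.pi)) *
      ∫⁻ θ in Ioc (0 : ℝ) (2 * Real.pi), ENNReal.ofReal (g (circleMap w ρ θ)) := by
  rw [circleAverage_eq_setIntegral, ENNReal.ofReal_mul (by positivity), one_div,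
    ofReal_integral_eq_lintegral_ofReal
      ((intervalIntegrable_iff_integrableOn_Ioc_of_le Real.two_pi_pos.le).1 hg)
      (ae_restrict_of_ae h0)]

/-- In the disk the kernel is the real part of the holomorphic function `(ζ + z) / (ζ - z)`, so
equality holds. -/
theorem hasSuperMean_poissonKernelDisk {ζ : ℂ} (hζ : ‖ζ‖ = 1) :
    HasSuperMean (poissonKernelDisk ζ) := by
  have hre : ∀ z ∈ ball (0 : ℂ) 1, (1 - ‖z‖ ^ 2) / ‖ζ - z‖ ^ 2 = ((ζ + z) / (ζ - z)).re :=
    fun z _ => by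
    have h1 : ζ.re * ζ.re + ζ.im * ζ.im = 1 := by
      rw [← Complex.normSq_apply, Complex.normSq_eq_norm_sq, hζ, one_pow]
    rw [Complex.div_re, ← Complex.normSq_eq_norm_sq, ← Complex.normSq_eq_norm_sq, ← add_div]
    congr 1
    simp only [Complex.normSq_apply, Complex.add_re, Complex.sub_re, Complex.add_im,
      Complex.sub_im]
    linear_combination -h1
  intro w ρ hρ hb
  have hne : ∀ z ∈ ball (0 : ℂ) 1, ζ - z ≠ 0 := fun z hz h => by
    rw [sub_eq_zero] at h
    simp [← h, hζ] at hz
  have hd : DifferentiableOn ℂ (fun z => (ζ + z) / (ζ - z)) (ball 0 1) :=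
    DifferentiableOn.div (by fun_prop) (by fun_prop) hne
  have hd' : DiffContOnCl ℂ (fun z => (ζ + z) / (ζ - z)) (ball w |ρ|) := by
    rw [abs_of_pos hρ]
    exact (hd.mono (closure_ball_subset_closedBall.trans hb)).diffContOnCl
  have hcs := hd.continuousOn.mono (sphere_subset_closedBall.trans hb)
  have hci := hcs.circleIntegrable hρ.le
  have hav := Complex.reCLM.circleAverage_comp_comm hci
  rw [hd'.circleAverage] at hav
  have hmem : ∀ θ, circleMap w ρ θ ∈ ball (0 : ℂ) 1 := fun θ =>
    hb (circleMap_mem_closedBall w hρ.le θ)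
  have hnn : ∀ z ∈ ball (0 : ℂ) 1, 0 ≤ ((ζ + z) / (ζ - z)).re := fun z hz => by
    rw [← hre z hz]
    have : ‖z‖ ^ 2 ≤ 1 := pow_le_one₀ (norm_nonneg _) (by simpa using (mem_ball.1 hz).le)
    have : 0 ≤ 1 - ‖z‖ ^ 2 := by linarith
    positivity
  have := ofReal_circleAverage (g := fun z => ((ζ + z) / (ζ - z)).re)
    ((Complex.continuous_re.comp_continuousOn hcs).circleIntegrable hρ.le)
    (Filter.Eventually.of_forall fun θ => hnn _ (hmem θ))
  simp only [poissonKernelDisk]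
  rw [hre w (hb (mem_closedBall_self hρ.le)), lintegral_congr fun θ => by rw [hre _ (hmem θ)],
    ← this]
  exact (congrArg ENNReal.ofReal hav).le

theorem norm_sub_le_norm_one_sub_conj_mul {ζ z : ℂ} (hζ : ‖ζ‖ ≤ 1) (hz : ‖z‖ ≤ 1) :
    ‖ζ - z‖ ≤ ‖1 - (starRingEnd ℂ) ζ * z‖ := by
  refine le_of_sq_le_sq ?_ (norm_nonneg _)
  have h1 : ‖ζ‖ ^ 2 ≤ 1 := pow_le_one₀ (norm_nonneg _) hζ
  have h2 : ‖z‖ ^ 2 ≤ 1 := pow_le_one₀ (norm_nonneg _) hz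
  have h3 : 0 ≤ (1 - ‖ζ‖ ^ 2) * (1 - ‖z‖ ^ 2) := mul_nonneg (by linarith) (by linarith)
  rw [← sub_nonneg]
  refine h3.trans_eq ?_
  simp only [← Complex.normSq_eq_norm_sq, Complex.normSq_apply, Complex.sub_re, Complex.sub_im,
    Complex.mul_re, Complex.mul_im, Complex.conj_re, Complex.conj_im, Complex.one_re,
    Complex.one_im]
  ring

theorem one_sub_conj_mul_ne_zero {ζ z : ℂ} (hζ : ‖ζ‖ < 1) (hz : ‖z‖ < 1) :
    1 - (starRingEnd ℂ) ζ * z ≠ 0 := fun h => by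
  have h1 : ‖(starRingEnd ℂ) ζ * z‖ = 1 := by rw [← sub_eq_zero.1 h, norm_one]
  rw [norm_mul, RCLike.norm_conj] at h1
  nlinarith [norm_nonneg ζ, norm_nonneg z]

/-- Jensen's formula: the mean is `log ρ + log⁺ (‖w - ζ‖ / ρ)`. -/
theorem log_norm_le_circleAverage {ζ w : ℂ} {ρ : ℝ} (hρ : 0 < ρ) (h : w ≠ ζ) :
    Real.log ‖w - ζ‖ ≤ Real.circleAverage (fun z => Real.log ‖z - ζ‖) w ρ := by
  rw [circleAverage_log_norm_sub_const_eq_log_radius_add_posLog hρ.ne']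
  have hpos : 0 < ‖w - ζ‖ := norm_pos_iff.2 (sub_ne_zero.2 h)
  have := le_max_right 0 (Real.log (ρ⁻¹ * ‖w - ζ‖))
  rw [Real.log_mul (inv_pos.2 hρ).ne' hpos.ne', Real.log_inv] at this
  rw [Real.posLog, Real.log_mul (inv_pos.2 hρ).ne' hpos.ne', Real.log_inv]
  linarith

theorem hasSuperMean_greenKernel {ζ : ℂ} (hζ : ‖ζ‖ < 1) : HasSuperMean (greenKernel ζ) := by
  intro w ρ hρ hb
  rcases eq_or_ne w ζ with rfl | hw
  · simp [greenKernel]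
  have hlt : ∀ z ∈ closedBall w ρ, ‖z‖ < 1 := fun z hz => by simpa using hb hz
  have hζ2 : ‖ζ‖ ^ 2 < 1 := pow_lt_one₀ (norm_nonneg _) hζ two_ne_zero
  have hk : 0 ≤ 2 / (1 - ‖ζ‖ ^ 2) := div_nonneg zero_le_two (by linarith)
  set k := 2 / (1 - ‖ζ‖ ^ 2)
  set g : ℂ → ℝ := fun z =>
    k • (Real.log ‖1 - (starRingEnd ℂ) ζ * z‖ - Real.log ‖z - ζ‖) with hg
  have hgk : ∀ z, ‖z‖ < 1 → z ≠ ζ → greenKernel ζ z = ENNReal.ofReal (g z) := fun z hz hne => by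
    rw [greenKernel, if_neg hne, norm_div, Real.log_div
      (norm_ne_zero_iff.2 (one_sub_conj_mul_ne_zero hζ hz))
      (norm_ne_zero_iff.2 (sub_ne_zero.2 hne.symm)), norm_sub_rev ζ z, mul_comm]
    rfl
  have hg0 : ∀ z, ‖z‖ < 1 → z ≠ ζ → 0 ≤ g z := fun z hz hne => by
    refine mul_nonneg hk (sub_nonneg.2 (Real.log_le_log
      (norm_pos_iff.2 (sub_ne_zero.2 hne)) ?_))
    rw [norm_sub_rev]
    exact norm_sub_le_norm_one_sub_conj_mul hζ.le hz.le
  -- The circle may pass through `ζ`, where the kernel is `∞` but `g` is finite; this happens only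
  -- for a null set of angles.
  have hae : ∀ᵐ θ : ℝ, circleMap w ρ θ ≠ ζ := by
    have := (countable_singleton ζ).preimage_circleMap w hρ.ne'
    exact this.ae_notMem volume
  have hmem : ∀ θ, ‖circleMap w ρ θ‖ < 1 := fun θ => hlt _ (circleMap_mem_closedBall w hρ.le θ)
  have han : AnalyticOnNhd ℂ (fun z => 1 - (starRingEnd ℂ) ζ * z) (closedBall w |ρ|) :=
    fun z _ => by fun_prop
  have hnz : ∀ z ∈ closedBall w |ρ|, 1 - (starRingEnd ℂ) ζ * z ≠ 0 := fun z hz => by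
    rw [abs_of_pos hρ] at hz
    exact one_sub_conj_mul_ne_zero hζ (hlt z hz)
  have hi1 : CircleIntegrable (fun z => Real.log ‖1 - (starRingEnd ℂ) ζ * z‖) w ρ := by
    refine ContinuousOn.circleIntegrable hρ.le (ContinuousOn.log (by fun_prop) fun z hz => ?_)
    exact norm_ne_zero_iff.2 (one_sub_conj_mul_ne_zero hζ (hlt z (sphere_subset_closedBall hz)))
  have hi2 : CircleIntegrable (fun z => Real.log ‖z - ζ‖) w ρ :=
    circleIntegrable_log_norm_sub_const ρ
  have hgi : CircleIntegrable g w ρ := (hi1.sub hi2).const_smul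
  have hav : Real.circleAverage g w ρ ≤ g w := by
    rw [hg, Real.circleAverage_fun_smul, Real.circleAverage_fun_sub hi1 hi2,
      han.circleAverage_log_norm_of_ne_zero hnz]
    exact mul_le_mul_of_nonneg_left (sub_le_sub_left (log_norm_le_circleAverage hρ hw) _) hk
  rw [hgk w (hlt w (mem_closedBall_self hρ.le)) hw]
  refine le_trans (le_of_eq ?_) (ENNReal.ofReal_le_ofReal hav)
  rw [ofReal_circleAverage hgi (hae.mono fun θ hθ => hg0 _ (hmem θ) hθ)]
  congr 1
  exact lintegral_congr_ae (ae_restrict_of_ae (hae.mono fun θ hθ => hgk _ (hmem θ) hθ))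

theorem HasSuperMean.add {ω₁ ω₂ : ℂ → ℝ≥0∞} (h₁ : HasSuperMean ω₁) (hm : Measurable ω₁)
    (h₂ : HasSuperMean ω₂) : HasSuperMean fun z => ω₁ z + ω₂ z := fun w ρ hρ hb => by
  simp only
  rw [lintegral_add_left (f := fun θ => ω₁ (circleMap w ρ θ))
    (hm.comp (continuous_circleMap w ρ).measurable), mul_add]
  exact add_le_add (h₁ w ρ hρ hb) (h₂ w ρ hρ hb)

/-- Tonelli exchanges the circle mean with the integral over the parameter. -/
theorem HasSuperMean.lintegral {X : Type*} [MeasurableSpace X] {ν : Measure X} [SFinite ν]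
    {κ : X → ℂ → ℝ≥0∞} (hm : Measurable (Function.uncurry κ))
    (h : ∀ᵐ x ∂ν, HasSuperMean (κ x)) : HasSuperMean fun z => ∫⁻ x, κ x z ∂ν :=
  fun w ρ hρ hb => by
  have hm' : Measurable fun p : ℝ × X => κ p.2 (circleMap w ρ p.1) :=
    hm.comp (measurable_snd.prodMk ((continuous_circleMap w ρ).measurable.comp measurable_fst))
  rw [lintegral_lintegral_swap hm'.aemeasurable, ← lintegral_const_mul _
    (Measurable.lintegral_prod_left' hm')]
  exact lintegral_mono_ae (h.mono fun x hx => hx w ρ hρ hb)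

theorem measurable_uncurry_greenKernel :
    Measurable (Function.uncurry fun ζ : closedBall (0 : ℂ) 1 => greenKernel ζ) := by
  have h1 : Measurable fun p : closedBall (0 : ℂ) 1 × ℂ => (p.1 : ℂ) :=
    measurable_subtype_coe.comp measurable_fst
  unfold Function.uncurry greenKernel
  refine Measurable.ite (measurableSet_eq_fun measurable_snd h1) measurable_const ?_
  have h2 : Measurable fun p : closedBall (0 : ℂ) 1 × ℂ => (starRingEnd ℂ) (p.1 : ℂ) :=
    Complex.continuous_conj.measurable.comp h1
  fun_prop

theorem measurable_uncurry_poissonKernelDisk :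
    Measurable (Function.uncurry fun ζ : closedBall (0 : ℂ) 1 => poissonKernelDisk ζ) := by
  have h1 : Measurable fun p : closedBall (0 : ℂ) 1 × ℂ => (p.1 : ℂ) :=
    measurable_subtype_coe.comp measurable_fst
  unfold Function.uncurry poissonKernelDisk
  fun_prop

section MeasureWeight

variable (μ : Measure (closedBall (0 : ℂ) 1)) [IsFiniteMeasure μ]

theorem measurable_measureWeight : Measurable (measureWeight μ) :=
  (Measurable.lintegral_prod_left' measurable_uncurry_greenKernel).add
    (Measurable.lintegral_prod_left' measurable_uncurry_poissonKernelDisk)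

theorem hasSuperMean_measureWeight : HasSuperMean (measureWeight μ) := by
  have hn : Measurable fun ζ : closedBall (0 : ℂ) 1 => ‖(ζ : ℂ)‖ := measurable_subtype_coe.norm
  refine HasSuperMean.add (HasSuperMean.lintegral measurable_uncurry_greenKernel ?_)
    (Measurable.lintegral_prod_left' measurable_uncurry_greenKernel)
    (HasSuperMean.lintegral measurable_uncurry_poissonKernelDisk ?_)
  · exact (ae_restrict_mem (measurableSet_lt hn measurable_const)).mono fun ζ hζ =>
      hasSuperMean_greenKernel hζ
  · exact (ae_restrict_mem (measurableSet_eq_fun hn measurable_const)).mono fun ζ hζ =>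
      hasSuperMean_poissonKernelDisk hζ

end MeasureWeight

end

theorem mainTheorem2 :
    (∀ (μ : Measure (closedBall (0 : ℂ) 1)) [IsFiniteMeasure μ] (f : ℂ → ℂ),
      MemDirichletSpace (measureWeight μ) f →
      ∀ r : ℝ, 0 ≤ r → r < 1 →
        dirichletIntegral (measureWeight μ) (dilation r f) ≤
          ENNReal.ofReal (2 * r / (1 + r)) * dirichletIntegral (measureWeight μ) f) ∧
    (∀ (ω : ℂ → ℝ≥0∞), IsSuperharmonicWeight ω → ∀ f : ℂ → ℂ,
      MemDirichletSpace ω f →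
      ∀ r : ℝ, 0 ≤ r → r < 1 →
        dirichletIntegral ω (dilation r f) ≤
            ENNReal.ofReal (2 * r / (1 + r)) * dirichletIntegral ω f ∧
        dirichletIntegral ω (dilation r f) ≤ dirichletIntegral ω f) := by
  refine ⟨fun μ _ f hf r hr hr1 => ?_, fun ω hω f hf r hr hr1 => ?_⟩
  · exact (dirichletIntegral_dilation_le hr hr1.le hf.1 (measurable_measureWeight μ)
      (hasSuperMean_measureWeight μ)).trans (mul_le_mul_left
        (ENNReal.ofReal_le_ofReal (le_two_mul_div_one_add hr hr1.le)) _)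
  · have key := dirichletIntegral_dilation_le hr hr1.le hf.1 hω.measurable_indicator
      hω.hasSuperMean_indicator
    rw [dirichletIntegral_indicator, dirichletIntegral_indicator] at key
    refine ⟨key.trans (mul_le_mul_left
      (ENNReal.ofReal_le_ofReal (le_two_mul_div_one_add hr hr1.le)) _), key.trans ?_⟩
    calc ENNReal.ofReal r * dirichletIntegral ω f ≤ 1 * dirichletIntegral ω f :=
          mul_le_mul_left (ENNReal.ofReal_le_one.2 hr1.le) _
      _ = _ := one_mul _
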